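/- Let $\Omega\subset\mathbb R^d$ be a bounded open set (for instance a bounded Lipschitz domain, $d\in\{1,2,3\}$), $T>0$, $Q=\Omega\times(0,T)$, and write $\|\cdot\|$, $\|\cdot\|_\Omega$ for the norms of $L^2(Q)$, $L^2(\Omega)$ (also for vector fields). Let $\sigma,\nu:\Omega\to\mathbb R$ be measurable with $0<\underline\sigma\le\sigma\le\overline\sigma$ and $0<\underline\nu\le\nu\le\overline\nu$ in $\Omega$, let $\lambda>0$, $y_d\in L^2(Q)$, and let $C_F>0$ be a constant in Friedrichs' inequality, $\|w\|_\Omega\le C_F\|\nabla w\|_\Omega$ for all $w\in H^1_0(\Omega)$. Put $\underline{\mu_1}=\frac1{\sqrt2}\min\{\underline\nu,\underline\sigma\}$. Spaces. $H^{1,0}_0(Q)$ is the set of $u\in L^2(Q)$ with $\nabla u\in L^2(Q)^d$ and $u(\cdot,t)\in H^1_0(\Omega)$ for a.e. $t$. $H^{1,1}_{0,per}(Q)$ is the set of $u\in H^{1,0}_0(Q)$ with weak time derivative $\partial_tu\in L^2(Q)$ and $u(0)=u(T)$ in $L^2(\Omega)$. $H(\mathrm{div},Q)$ is the set of $\tau\in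 L^2(Q)^d$ with $\nabla\cdot\tau(\cdot,t)\in L^2(\Omega)$ for a.e. $t$. With $\omega=2\pi/T$, $u_k^c=\frac2T\int_0^Tu\cos(k\omega t)\,dt$, $u_k^s=\frac2T\int_0^Tu\sin(k\omega t)\,dt$, the space $H^{1,1/2}_{0,per}(Q)$ consists of the $u\in H^{1,0}_0(Q)$ with $\sum_{k\ge1}k\omega(\|u_k^c\|_\Omega^2+\|u_k^s\|_\Omega^2)<\infty$. Optimal control problem. Minimize $$\mathcal J(y,u)=\tfrac12\|y-y_d\|^2+\tfrac\lambda2\|u\|^2$$ over all $u\in L^2(Q)$ and $y\in H^{1,1/2}_{0,per}(Q)$ such that $y$ is a weak solution of $\sigma\partial_ty-\nabla\cdot(\nu\nabla y)=u$ in $Q$, $y=0$ on $\partial\Omega\times(0,T)$, $y(0)=y(T)$, that is, $$\int_Q\nu\nabla y\cdot\nabla q\,dx\,dt+\frac T2\sum_{k\ge1}k\omega\int_\Omega\sigma\,(y_k^sq_k^c-y_k^cq_k^s)\,dx=\int_Qu\,q\,dx\,dt\qquad\forall q\in H^{1,1/2}_{0,per}(Q).$$ Claim. For all $\eta,\zeta\in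 H^{1,1}_{0,per}(Q)$ and $\tau,\rho\in H(\mathrm{div},Q)$, the optimal value (the infimum of $\mathcal J$ over all such pairs) is at least $\mathcal J^\ominus(\eta,\zeta,\tau,\rho)$; in particular $\mathcal J(y(u),u)\ge\mathcal J^\ominus(\eta,\zeta,\tau,\rho)$ for every optimal control $u$ with state $y(u)$. Here $$\begin{aligned}\mathcal J^\ominus(\eta,\zeta,\tau,\rho)={}&\tfrac12\|\eta-y_d\|^2+\tfrac1{2\lambda}\|\zeta\|^2-\int_Q\big(\nu\nabla\eta\cdot\nabla\zeta+\sigma\,\partial_t\eta\,\zeta+\lambda^{-1}\zeta^2\big)\,dx\,dt\\&-\frac{C_F^2}{\underline{\mu_1}^2\lambda}\big(C_F\|\mathcal R_3(\zeta,\rho,\eta)\|+\|\mathcal R_4(\zeta,\rho)\|\big)^2\\&-\frac1{\underline{\mu_1}}\big(C_F\|\mathcal R_1(\eta,\tau,-\lambda^{-1}\zeta)\|+\|\mathcal R_2(\eta,\tau)\|\big)\big(C_F\|\mathcal R_3(\zeta,\rho,\eta)\|+\|\mathcal R_4(\zeta,\rho)\|\big)\end{aligned}$$ with $\mathcal R_1(\eta,\tau,v)=\sigma\partial_t\eta-\nabla\cdot\tau-v$,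 $\mathcal R_2(\eta,\tau)=\tau-\nu\nabla\eta$, $\mathcal R_3(\zeta,\rho,\eta)=\eta-y_d+\nabla\cdot\rho+\sigma\partial_t\zeta$, $\mathcal R_4(\zeta,\rho)=\rho-\nu\nabla\zeta$. (If $\nabla\cdot\tau$ or $\nabla\cdot\rho$ is not in $L^2(Q)$, the corresponding norm is $\infty$ and $\mathcal J^\ominus$ is read in $[-\infty,\infty)$ with $\infty\cdot0=0$.) -/

import Mathlib

open MeasureTheory Set Filter Topology
open scoped ENNReal ContDiff

noncomputable section

namespace TimePeriodicControl

/-- The space `ℝ^d` with its Euclidean norm. -/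
abbrev Sp (d : ℕ) : Type := EuclideanSpace ℝ (Fin d)

/-- Lebesgue measure on the spatial domain `Ω`. -/
abbrev muOmega {d : ℕ} (Ω : Set (Sp d)) : Measure (Sp d) := volume.restrict Ω

/-- Lebesgue measure on the space-time cylinder `Q = Ω × (0,T)`. -/
abbrev muQ {d : ℕ} (Ω : Set (Sp d)) (T : ℝ) : Measure (Sp d × ℝ) :=
  volume.restrict (Ω ×ˢ Ioo 0 T)

/-- `φ ∈ C_c^∞(U)`. -/
structure IsTest {F : Type*} [NormedAddCommGroup F] [NormedSpace ℝ F]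
    (U : Set F) (φ : F → ℝ) : Prop where
  smooth : ContDiff ℝ ∞ φ
  compact_support : HasCompactSupport φ
  support_subset : tsupport φ ⊆ U

/-- `w ∈ H^1_0(Ω)` with gradient `g`: the pair `(w, g)` lies in the closure in
`L²(Ω) × L²(Ω)^d` of the pairs `(φ, ∇φ)`, `φ ∈ C_c^∞(Ω)`. -/
structure IsH1Zero {d : ℕ} (Ω : Set (Sp d)) (w : Sp d → ℝ) (g : Sp d → Sp d) : Prop where
  memLp : MemLp w 2 (muOmega Ω)
  memLp_grad : MemLp g 2 (muOmega Ω)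
  approx : ∃ φ : ℕ → Sp d → ℝ, (∀ n, IsTest Ω (φ n)) ∧
    Tendsto (fun n => eLpNorm (fun x => φ n x - w x) 2 (muOmega Ω)) atTop (𝓝 0) ∧
    Tendsto (fun n => eLpNorm (fun x => gradient (φ n) x - g x) 2 (muOmega Ω)) atTop (𝓝 0)

/-- `C` is a constant in Friedrichs' inequality `‖w‖_Ω ≤ C ‖∇w‖_Ω` on `H^1_0(Ω)`. -/
def IsFriedrichsConstant {d : ℕ} (Ω : Set (Sp d)) (C : ℝ) : Prop :=
  0 < C ∧ ∀ (w : Sp d → ℝ) (g : Sp d → Sp d), IsH1Zero Ω w g →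
    eLpNorm w 2 (muOmega Ω) ≤ ENNReal.ofReal C * eLpNorm g 2 (muOmega Ω)

/-- `H^{1,0}_0(Q)`: functions `u ∈ L²(Q)` with spatial gradient in `L²(Q)^d` and vanishing on
the lateral surface, that is, `u(·,t) ∈ H^1_0(Ω)` for almost every `t`. An element carries
its spatial gradient, which is determined almost everywhere. -/
structure H10Zero {d : ℕ} (Ω : Set (Sp d)) (T : ℝ) where
  toFun : Sp d × ℝ → ℝ
  grad : Sp d × ℝ → Sp d
  memLp : MemLp toFun 2 (muQ Ω T)
  memLp_grad : MemLp grad 2 (muQ Ω T)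
  slice : ∀ᵐ t ∂(volume.restrict (Ioo 0 T)),
    IsH1Zero Ω (fun x => toFun (x, t)) (fun x => grad (x, t))

/-- `g` is the weak time derivative of `u` in `Q`. -/
def IsWeakTimeDeriv {d : ℕ} (Ω : Set (Sp d)) (T : ℝ) (u g : Sp d × ℝ → ℝ) : Prop :=
  ∀ φ : Sp d × ℝ → ℝ, IsTest (Ω ×ˢ Ioo 0 T) φ →
    ∫ z, u z * deriv (fun s => φ (z.1, s)) z.2 ∂(muQ Ω T) = - ∫ z, g z * φ z ∂(muQ Ω T)

/-- `u(0) = u(T)`: the representative of `u` in `C([0,T]; L²(Ω))` takes the same value at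
`0` and `T`. -/
def IsTimePeriodic {d : ℕ} (Ω : Set (Sp d)) (T : ℝ) (u : Sp d × ℝ → ℝ) : Prop :=
  ∃ U : ℝ → Lp ℝ 2 (muOmega Ω), ContinuousOn U (Icc 0 T) ∧
    (∀ᵐ t ∂(volume.restrict (Ioo 0 T)), U t =ᵐ[muOmega Ω] fun x => u (x, t)) ∧
    U 0 = U T

/-- `H^{1,1}_{0,per}(Q)`. An element carries its gradient and its weak time derivative. -/
structure H11ZeroPer {d : ℕ} (Ω : Set (Sp d)) (T : ℝ) extends H10Zero Ω T where
  dt : Sp d × ℝ → ℝ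
  memLp_dt : MemLp dt 2 (muQ Ω T)
  isWeakTimeDeriv : IsWeakTimeDeriv Ω T toFun dt
  isTimePeriodic : IsTimePeriodic Ω T toFun

/-- The frequency `ω = 2π / T`. -/
def freq (T : ℝ) : ℝ := 2 * Real.pi / T

/-- The Fourier coefficient `u_k^c(x)`, `k ≥ 1`. -/
def coefCos {d : ℕ} (T : ℝ) (u : Sp d × ℝ → ℝ) (k : ℕ) (x : Sp d) : ℝ :=
  2 / T * ∫ t in Ioo 0 T, u (x, t) * Real.cos (k * freq T * t)

/-- The Fourier coefficient `u_k^s(x)`, `k ≥ 1`. -/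
def coefSin {d : ℕ} (T : ℝ) (u : Sp d × ℝ → ℝ) (k : ℕ) (x : Sp d) : ℝ :=
  2 / T * ∫ t in Ioo 0 T, u (x, t) * Real.sin (k * freq T * t)

/-- `H^{1,1/2}_{0,per}(Q)`: elements `u` of `H^{1,0}_0(Q)` with
`∑_{k ≥ 1} k ω (‖u_k^c‖_Ω² + ‖u_k^s‖_Ω²) < ∞` (the term `k = 0` below is zero). -/
structure HHalfZeroPer {d : ℕ} (Ω : Set (Sp d)) (T : ℝ) extends H10Zero Ω T where
  summable_half : Summable fun k : ℕ => k * freq T *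
    ∫ x, (coefCos T toFun k x ^ 2 + coefSin T toFun k x ^ 2) ∂(muOmega Ω)

/-- `⟨σ ∂_t^{1/2} y, ∂_t^{1/2} q^⊥⟩ = (T/2) ∑_{k ≥ 1} k ω ⟨σ y_k, q_k^⊥⟩_Ω` with
`y_k = (y_k^c, y_k^s)` and `q_k^⊥ = (-q_k^s, q_k^c)`. For `y` with `∂_t y ∈ L²(Q)`,
`y(0) = y(T)`, this is `⟨σ ∂_t y, q⟩`. -/
def halfForm {d : ℕ} (Ω : Set (Sp d)) (T : ℝ) (σ : Sp d → ℝ) (y q : Sp d × ℝ → ℝ) : ℝ :=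
  T / 2 * ∑' k : ℕ, k * freq T *
    ∫ x, σ x * (coefCos T y k x * (-coefSin T q k x) + coefSin T y k x * coefCos T q k x)
      ∂(muOmega Ω)

/-- `y` is a (weak) state for the control `u`, that is, a weak solution of
`σ ∂_t y - ∇·(ν ∇y) = u` in `Q`, `y = 0` on `∂Ω × (0,T)`, `y(0) = y(T)`. -/
def IsState {d : ℕ} (Ω : Set (Sp d)) (T : ℝ) (σ ν : Sp d → ℝ)
    (y : HHalfZeroPer Ω T) (u : Sp d × ℝ → ℝ) : Prop :=
  ∀ q : HHalfZeroPer Ω T,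
    ∫ z, ν z.1 * inner ℝ (y.grad z) (q.grad z) ∂(muQ Ω T) + halfForm Ω T σ y.toFun q.toFun
      = ∫ z, u z * q.toFun z ∂(muQ Ω T)

/-- The norm of `L²(Q)` (or `L²(Q)^d`), with the value `∞` outside of this space. -/
def normQ {d : ℕ} {F : Type*} [NormedAddCommGroup F] (Ω : Set (Sp d)) (T : ℝ)
    (f : Sp d × ℝ → F) : ℝ≥0∞ :=
  eLpNorm f 2 (muQ Ω T)

/-- The cost functional `J(y,u) = ½ ‖y - y_d‖² + (λ/2) ‖u‖²`. -/
def cost {d : ℕ} (Ω : Set (Sp d)) (T lam : ℝ) (yd y u : Sp d × ℝ → ℝ) : ℝ :=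
  1 / 2 * (normQ Ω T (fun z => y z - yd z)).toReal ^ 2 + lam / 2 * (normQ Ω T u).toReal ^ 2

/-- `(y,u)` is admissible: `u ∈ L²(Q)` and `y` is a state for `u`. -/
def IsAdmissible {d : ℕ} (Ω : Set (Sp d)) (T : ℝ) (σ ν : Sp d → ℝ)
    (y : HHalfZeroPer Ω T) (u : Sp d × ℝ → ℝ) : Prop :=
  MemLp u 2 (muQ Ω T) ∧ IsState Ω T σ ν y u

/-- `u` is an optimal control and `y` its state. -/
def IsOptimal {d : ℕ} (Ω : Set (Sp d)) (T : ℝ) (σ ν : Sp d → ℝ) (lam : ℝ)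
    (yd : Sp d × ℝ → ℝ) (y : HHalfZeroPer Ω T) (u : Sp d × ℝ → ℝ) : Prop :=
  IsAdmissible Ω T σ ν y u ∧
    ∀ (z : HHalfZeroPer Ω T) (v : Sp d × ℝ → ℝ), IsAdmissible Ω T σ ν z v →
      cost Ω T lam yd y.toFun u ≤ cost Ω T lam yd z.toFun v

/-- The optimal value: the infimum of the cost over all admissible pairs. -/
def optimalValue {d : ℕ} (Ω : Set (Sp d)) (T : ℝ) (σ ν : Sp d → ℝ) (lam : ℝ)
    (yd : Sp d × ℝ → ℝ) : EReal :=
  ⨅ (y : HHalfZeroPer Ω T) (u : Sp d × ℝ → ℝ) (_ : IsAdmissible Ω T σ ν y u),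
    (cost Ω T lam yd y.toFun u : EReal)

/-- `H(div,Q)`: fields `τ ∈ L²(Q)^d` with `∇·τ(·,t) ∈ L²(Ω)` for almost every `t`. An element
carries its (weak, spatial) divergence, which is determined almost everywhere. -/
structure HDiv {d : ℕ} (Ω : Set (Sp d)) (T : ℝ) where
  toFun : Sp d × ℝ → Sp d
  div : Sp d × ℝ → ℝ
  memLp : MemLp toFun 2 (muQ Ω T)
  aestronglyMeasurable_div : AEStronglyMeasurable div (muQ Ω T)
  memLp_div : ∀ᵐ t ∂(volume.restrict (Ioo 0 T)), MemLp (fun x => div (x, t)) 2 (muOmega Ω)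
  isDiv : ∀ᵐ t ∂(volume.restrict (Ioo 0 T)), ∀ φ : Sp d → ℝ, IsTest Ω φ →
    ∫ x, div (x, t) * φ x ∂(muOmega Ω)
      = - ∫ x, inner ℝ (toFun (x, t)) (gradient φ x) ∂(muOmega Ω)

/-- `R₁(η,τ,v) = σ ∂_t η - ∇·τ - v`. -/
def R1 {d : ℕ} {Ω : Set (Sp d)} {T : ℝ} (σ : Sp d → ℝ) (η : H11ZeroPer Ω T) (τ : HDiv Ω T)
    (v : Sp d × ℝ → ℝ) : Sp d × ℝ → ℝ :=
  fun z => σ z.1 * η.dt z - τ.div z - v z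

/-- `R₂(η,τ) = τ - ν ∇η`. -/
def R2 {d : ℕ} {Ω : Set (Sp d)} {T : ℝ} (ν : Sp d → ℝ) (η : H11ZeroPer Ω T) (τ : HDiv Ω T) :
    Sp d × ℝ → Sp d :=
  fun z => τ.toFun z - ν z.1 • η.grad z

/-- `R₃(ζ,ρ,η) = η - y_d + ∇·ρ + σ ∂_t ζ`. -/
def R3 {d : ℕ} {Ω : Set (Sp d)} {T : ℝ} (σ : Sp d → ℝ) (yd : Sp d × ℝ → ℝ)
    (ζ : H11ZeroPer Ω T) (ρ : HDiv Ω T) (η : H11ZeroPer Ω T) : Sp d × ℝ → ℝ :=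
  fun z => η.toFun z - yd z + ρ.div z + σ z.1 * ζ.dt z

/-- `R₄(ζ,ρ) = ρ - ν ∇ζ`. -/
def R4 {d : ℕ} {Ω : Set (Sp d)} {T : ℝ} (ν : Sp d → ℝ) (ζ : H11ZeroPer Ω T) (ρ : HDiv Ω T) :
    Sp d × ℝ → Sp d :=
  fun z => ρ.toFun z - ν z.1 • ζ.grad z

/-- `μ₁ = min{ν_low, σ_low} / √2`. -/
def mu1 (νlow σlow : ℝ) : ℝ := min νlow σlow / √2

/-- The minorant `J^⊖(η,ζ,τ,ρ)`. It is real unless a divergence fails to lie in `L²(Q)`; then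
some `‖R_i‖` is `∞` and the expression is read in the extended reals, with `∞ · 0 = 0`. -/
def minorant {d : ℕ} {Ω : Set (Sp d)} {T : ℝ} (σ ν : Sp d → ℝ) (σlow νlow lam CF : ℝ)
    (yd : Sp d × ℝ → ℝ) (η ζ : H11ZeroPer Ω T) (τ ρ : HDiv Ω T) : EReal :=
  ((1 / 2 * (normQ Ω T (fun z => η.toFun z - yd z)).toReal ^ 2
      + 1 / (2 * lam) * (normQ Ω T ζ.toFun).toReal ^ 2
      - ∫ z, (ν z.1 * inner ℝ (η.grad z) (ζ.grad z) + σ z.1 * η.dt z * ζ.toFun z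
          + lam⁻¹ * ζ.toFun z ^ 2) ∂(muQ Ω T) : ℝ) : EReal)
  - ((ENNReal.ofReal (CF ^ 2 / (mu1 νlow σlow ^ 2 * lam)) *
        (ENNReal.ofReal CF * normQ Ω T (R3 σ yd ζ ρ η) + normQ Ω T (R4 ν ζ ρ)) ^ 2 : ℝ≥0∞)
      : EReal)
  - ((ENNReal.ofReal (1 / mu1 νlow σlow) *
        (ENNReal.ofReal CF * normQ Ω T (R1 σ η τ (fun z => -lam⁻¹ * ζ.toFun z))
          + normQ Ω T (R2 ν η τ)) *
        (ENNReal.ofReal CF * normQ Ω T (R3 σ yd ζ ρ η) + normQ Ω T (R4 ν ζ ρ)) : ℝ≥0∞)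
      : EReal)

end TimePeriodicControl

end

open TimePeriodicControl

/-! The bound holds for every admissible pair `(y, u)`; neither existence of a minimizer nor an
optimality system enters. Put `e = y - η` and `w = u + λ⁻¹ ζ`. The quadratic cost is expanded around
`(η, -λ⁻¹ ζ)`, and its linear part is rewritten by testing the state equation with `ζ` and
integrating `ρ` by parts in space. This gives the exact identity `cost_expansion`: the cost is the
real part of the minorant plus `λ/2 ‖w‖² + 1/2 ‖e‖² + ∫ R₃ e + ∫ R₄ · ∇e`. Dropping `1/2 ‖e‖²` and
using Cauchy-Schwarz and Friedrichs leaves `λ/2 ‖w‖² - A ‖∇e‖` with `A = C_F ‖R₃‖ + ‖R₄‖`.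

The deviation `∇e` is controlled by `gradient_deviation_le`: the state equation is tested with `e`
itself, where the time form vanishes on `(e, e)` by antisymmetry. Hence `ν_low ‖∇e‖ ≤ C_F ‖w‖ + B`
with `B = C_F ‖R₁‖ + ‖R₂‖`, and `ν_low` may be replaced by the smaller `μ₁`. Completing the square
in `‖w‖` (`young_bound`) finishes the finite case.

The analytic work lies in the time term, which for the state is only a Fourier series. Both tests
need it to equal `∫ σ ∂_t η q` when its first argument has a weak time derivative
(`halfForm_eq_integral`). This follows from Parseval once the coefficients of `∂_t η` are known
(`ae_coef_dt`). Since the weak derivative is defined by compactly supported tests, sines and cosines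
must first be admitted as tests. A cutoff in time does this, and its boundary terms cancel because
`η(0) = η(T)`. -/

noncomputable section

namespace TimePeriodicControl

/-! ### Real Fourier coefficients in time and Parseval's identity -/

/-- The cosine coefficient of a function of time. -/
def cosCoef (T : ℝ) (f : ℝ → ℝ) (k : ℕ) : ℝ :=
  2 / T * ∫ t in Ioo 0 T, f t * Real.cos (k * freq T * t)

/-- The sine coefficient of a function of time. -/
def sinCoef (T : ℝ) (f : ℝ → ℝ) (k : ℕ) : ℝ :=
  2 / T * ∫ t in Ioo 0 T, f t * Real.sin (k * freq T * t)

theorem sinCoef_zero (T : ℝ) (f : ℝ → ℝ) : sinCoef T f 0 = 0 := by simp [sinCoef]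

theorem integrable_mul_cos {f : ℝ → ℝ} {μ : Measure ℝ} (hf : Integrable f μ) (a : ℝ) :
    Integrable (fun t => f t * Real.cos (a * t)) μ :=
  hf.mul_bdd (c := 1) (by fun_prop) (ae_of_all _ fun t => by
    simpa using Real.abs_cos_le_one (a * t))

theorem integrable_mul_sin {f : ℝ → ℝ} {μ : Measure ℝ} (hf : Integrable f μ) (a : ℝ) :
    Integrable (fun t => f t * Real.sin (a * t)) μ :=
  hf.mul_bdd (c := 1) (by fun_prop) (ae_of_all _ fun t => by
    simpa using Real.abs_sin_le_one (a * t))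

section
variable {T : ℝ} {f h : ℝ → ℝ}

theorem cosCoef_add (hf : IntegrableOn f (Ioo 0 T)) (hh : IntegrableOn h (Ioo 0 T)) (k : ℕ) :
    cosCoef T (fun t => f t + h t) k = cosCoef T f k + cosCoef T h k := by
  simp only [cosCoef, add_mul]
  rw [integral_add (integrable_mul_cos hf _) (integrable_mul_cos hh _), mul_add]

theorem sinCoef_add (hf : IntegrableOn f (Ioo 0 T)) (hh : IntegrableOn h (Ioo 0 T)) (k : ℕ) :
    sinCoef T (fun t => f t + h t) k = sinCoef T f k + sinCoef T h k := by
  simp only [sinCoef, add_mul]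
  rw [integral_add (integrable_mul_sin hf _) (integrable_mul_sin hh _), mul_add]

theorem cosCoef_sub (hf : IntegrableOn f (Ioo 0 T)) (hh : IntegrableOn h (Ioo 0 T)) (k : ℕ) :
    cosCoef T (fun t => f t - h t) k = cosCoef T f k - cosCoef T h k := by
  simp only [cosCoef, sub_mul]
  rw [integral_sub (integrable_mul_cos hf _) (integrable_mul_cos hh _), mul_sub]

theorem sinCoef_sub (hf : IntegrableOn f (Ioo 0 T)) (hh : IntegrableOn h (Ioo 0 T)) (k : ℕ) :
    sinCoef T (fun t => f t - h t) k = sinCoef T f k - sinCoef T h k := by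
  simp only [sinCoef, sub_mul]
  rw [integral_sub (integrable_mul_sin hf _) (integrable_mul_sin hh _), mul_sub]

/-- Euler's formula in the integrand; this transfers the complex Parseval identity to cosine and
sine coefficients. -/
theorem fourierCoeffOn_ofReal (hT : 0 < T) (hf : IntegrableOn f (Ioo 0 T)) (k : ℕ) :
    fourierCoeffOn hT (fun t => (f t : ℂ)) k
        = ((cosCoef T f k / 2 : ℝ) : ℂ) - ((sinCoef T f k / 2 : ℝ) : ℂ) * Complex.I ∧
      fourierCoeffOn hT (fun t => (f t : ℂ)) (-k)
        = ((cosCoef T f k / 2 : ℝ) : ℂ) + ((sinCoef T f k / 2 : ℝ) : ℂ) * Complex.I := by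
  have hc : IntegrableOn (fun t => ((f t * Real.cos (k * freq T * t) : ℝ) : ℂ)) (Ioo 0 T) :=
    (integrable_mul_cos hf (k * freq T)).ofReal (𝕜 := ℂ)
  have hs : IntegrableOn (fun t => ((f t * Real.sin (k * freq T * t) : ℝ) : ℂ) * Complex.I)
      (Ioo 0 T) := ((integrable_mul_sin hf (k * freq T)).ofReal (𝕜 := ℂ)).mul_const Complex.I
  have e1 : ∀ t : ℝ, fourier (-(k : ℤ)) (t : AddCircle (T - 0)) • (f t : ℂ)
      = ((f t * Real.cos (k * freq T * t) : ℝ) : ℂ)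
        - ((f t * Real.sin (k * freq T * t) : ℝ) : ℂ) * Complex.I := by
    intro t
    have : (2 * Real.pi * Complex.I * ((-(k : ℤ) : ℤ) : ℂ) * t / ((T - 0 : ℝ) : ℂ))
        = ((-(k * freq T * t) : ℝ) : ℂ) * Complex.I := by
      simp only [freq]; push_cast; rw [sub_zero]; ring
    rw [fourier_coe_apply, this, Complex.exp_mul_I, ← Complex.ofReal_cos, ← Complex.ofReal_sin,
      Real.cos_neg, Real.sin_neg, smul_eq_mul]
    push_cast; ring
  have e2 : ∀ t : ℝ, fourier (-(-(k : ℤ))) (t : AddCircle (T - 0)) • (f t : ℂ)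
      = ((f t * Real.cos (k * freq T * t) : ℝ) : ℂ)
        + ((f t * Real.sin (k * freq T * t) : ℝ) : ℂ) * Complex.I := by
    intro t
    have : (2 * Real.pi * Complex.I * ((-(-(k : ℤ)) : ℤ) : ℂ) * t / ((T - 0 : ℝ) : ℂ))
        = ((k * freq T * t : ℝ) : ℂ) * Complex.I := by
      simp only [freq]; push_cast; rw [sub_zero]; ring
    rw [fourier_coe_apply, this, Complex.exp_mul_I, ← Complex.ofReal_cos, ← Complex.ofReal_sin,
      smul_eq_mul]
    push_cast; ring
  constructor
  · rw [fourierCoeffOn_eq_integral, intervalIntegral.integral_of_le hT.le,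
      integral_Ioc_eq_integral_Ioo]
    simp_rw [e1]
    rw [integral_sub hc hs, integral_mul_const]
    simp only [integral_complex_ofReal, cosCoef, sinCoef]
    rw [Complex.real_smul]
    push_cast
    rw [sub_zero]; ring
  · rw [fourierCoeffOn_eq_integral, intervalIntegral.integral_of_le hT.le,
      integral_Ioc_eq_integral_Ioo]
    simp_rw [e2]
    rw [integral_add hc hs, integral_mul_const]
    simp only [integral_complex_ofReal, cosCoef, sinCoef]
    rw [Complex.real_smul]
    push_cast
    rw [sub_zero]; ring

theorem integrableOn_of_memLp_two (hf : MemLp f 2 (volume.restrict (Ioo 0 T))) :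
    IntegrableOn f (Ioo 0 T) :=
  hf.integrable (by norm_num)

/-- **Parseval's identity** for real Fourier series. -/
theorem hasSum_sq_coef (hT : 0 < T) (hf : MemLp f 2 (volume.restrict (Ioo 0 T))) :
    HasSum (fun k : ℕ => cosCoef T f k ^ 2 + sinCoef T f k ^ 2)
      (2 / T * (∫ t in Ioo 0 T, f t ^ 2) + 1 / 2 * cosCoef T f 0 ^ 2) := by
  have hfC : MemLp (fun t => (f t : ℂ)) 2 (volume.restrict (Ioc 0 T)) := by
    rw [restrict_Ioo_eq_restrict_Ioc.symm]; exact hf.ofReal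
  have hi := integrableOn_of_memLp_two hf
  -- Folding the series over `ℤ` onto pairs `±k` counts the index `0` twice; this is the source of
  -- the extra term `1/2 * cosCoef T f 0 ^ 2`.
  have h := ((hasSum_sq_fourierCoeffOn hT hfC).nat_add_neg).mul_left 2
  have n1 : ∀ a b : ℝ, ‖(a : ℂ) - b * Complex.I‖ ^ 2 = a ^ 2 + b ^ 2 := fun a b => by
    rw [← Complex.normSq_eq_norm_sq, Complex.normSq_apply]; simp; ring
  have n2 : ∀ a b : ℝ, ‖(a : ℂ) + b * Complex.I‖ ^ 2 = a ^ 2 + b ^ 2 := fun a b => by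
    rw [← Complex.normSq_eq_norm_sq, Complex.normSq_apply]; simp; ring
  convert! h using 1
  · ext k
    rw [(fourierCoeffOn_ofReal hT hi k).1, (fourierCoeffOn_ofReal hT hi k).2, n1, n2]; ring
  · have := (fourierCoeffOn_ofReal hT hi 0).1
    rw [Nat.cast_zero] at this
    rw [this, n1, sinCoef_zero, intervalIntegral.integral_of_le hT.le,
      integral_Ioc_eq_integral_Ioo]
    simp only [Complex.norm_real, Real.norm_eq_abs, sq_abs, smul_eq_mul, sub_zero]
    ring

/-- Polarization of Parseval's identity, applied to `f + h` and `f - h`. -/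
theorem hasSum_mul_coef (hT : 0 < T) (hf : MemLp f 2 (volume.restrict (Ioo 0 T)))
    (hh : MemLp h 2 (volume.restrict (Ioo 0 T))) :
    HasSum (fun k : ℕ => cosCoef T f k * cosCoef T h k + sinCoef T f k * sinCoef T h k)
      (2 / T * (∫ t in Ioo 0 T, f t * h t) + 1 / 2 * (cosCoef T f 0 * cosCoef T h 0)) := by
  have hfi := integrableOn_of_memLp_two hf
  have hhi := integrableOn_of_memLp_two hh
  have ha := hasSum_sq_coef hT (hf.add hh)
  have hs := hasSum_sq_coef hT (hf.sub hh)
  simp only [Pi.add_def, cosCoef_add hfi hhi, sinCoef_add hfi hhi] at ha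
  simp only [Pi.sub_def, cosCoef_sub hfi hhi, sinCoef_sub hfi hhi] at hs
  have hI : ∫ t in Ioo 0 T, f t * h t
      = ((∫ t in Ioo 0 T, (f t + h t) ^ 2) - ∫ t in Ioo 0 T, (f t - h t) ^ 2) / 4 := by
    have e := integral_sub (hf.add hh).integrable_sq (hf.sub hh).integrable_sq
    simp only [Pi.add_apply, Pi.sub_apply] at e
    rw [← e, ← integral_div]
    congr with t
    ring
  convert! (ha.sub hs).div_const 4 using 1
  · ext k; ring
  · rw [hI]; ring

end

/-! ### Cutoffs in time and periodic test functions -/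

section
variable {T : ℝ}

theorem deriv_smoothTransition_eq_zero {x : ℝ} (hx : x ∉ Icc (0 : ℝ) 1) :
    deriv Real.smoothTransition x = 0 := by
  rw [mem_Icc, not_and_or, not_le, not_le] at hx
  rcases hx with hx | hx
  · have : Real.smoothTransition =ᶠ[𝓝 x] fun _ => 0 := by
      filter_upwards [Iio_mem_nhds hx] with y hy
      exact Real.smoothTransition.zero_of_nonpos (le_of_lt hy)
    rw [this.deriv_eq, deriv_const]
  · have : Real.smoothTransition =ᶠ[𝓝 x] fun _ => 1 := by
      filter_upwards [Ioi_mem_nhds hx] with y hy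
      exact Real.smoothTransition.one_of_one_le (le_of_lt hy)
    rw [this.deriv_eq, deriv_const]

theorem exists_deriv_smoothTransition_bound :
    ∃ M : ℝ, 0 ≤ M ∧ ∀ x, |deriv Real.smoothTransition x| ≤ M := by
  have hc : Continuous (deriv Real.smoothTransition) :=
    (Real.smoothTransition.contDiff (n := 1)).continuous_deriv le_rfl
  obtain ⟨M, hM⟩ := (isCompact_Icc (a := (0 : ℝ)) (b := 1)).exists_bound_of_continuousOn
    hc.continuousOn
  refine ⟨|M|, abs_nonneg _, fun x => ?_⟩
  by_cases hx : x ∈ Icc (0 : ℝ) 1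
  · exact (hM x hx).trans (le_abs_self M)
  · rw [deriv_smoothTransition_eq_zero hx, abs_zero]; exact abs_nonneg _

/-- The kernel has size `O(n)` on a layer of width `1/n` at `0`, so its mass stays bounded while `P`
is uniformly small on the layer. The bounded weight `w` leaves room for the other factor of the
cutoff. -/
theorem tendsto_integral_boundary_layer {P : ℝ → ℝ} (hT : 0 < T) (hP : ContinuousOn P (Icc 0 T))
    (hP0 : P 0 = 0) {w : ℕ → ℝ → ℝ} (hw : ∀ n t, |w n t| ≤ 1) :
    Tendsto (fun n : ℕ => ∫ t in Ioo 0 T,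
      P t * (n * deriv Real.smoothTransition (n * t - 1) * w n t)) atTop (𝓝 0) := by
  obtain ⟨M, hM0, hM⟩ := exists_deriv_smoothTransition_bound
  rw [Metric.tendsto_atTop]
  intro ε hε
  -- The layer `[1/n, 2/n]` has length `1/n` and the kernel is at most `n M` there, so this bound on
  -- `P` gives `ε M / (M + 1) < ε`, also when `M = 0`.
  have hε' : 0 < ε / (M + 1) := by positivity
  obtain ⟨δ, hδ, hPδ⟩ := Metric.continuousOn_iff.1 hP 0 (left_mem_Icc.2 hT.le) _ hε'
  obtain ⟨N, hN⟩ := exists_nat_gt (2 / δ)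
  refine ⟨max N 1, fun n hn => ?_⟩
  have hn1 : (1 : ℝ) ≤ n := by exact_mod_cast (le_max_right _ _).trans hn
  have hn0 : (0 : ℝ) < n := by linarith
  have hnδ : 2 < n * δ := by
    have : (N : ℝ) ≤ n := by exact_mod_cast (le_max_left _ _).trans hn
    rw [div_lt_iff₀ hδ] at hN
    nlinarith
  have hbd : ∀ t ∈ Ioo 0 T, ‖P t * (n * deriv Real.smoothTransition (n * t - 1) * w n t)‖
      ≤ (Icc (1 / n : ℝ) (2 / n)).indicator (fun _ => ε / (M + 1) * (n * M)) t := by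
    intro t ht
    by_cases hmem : t ∈ Icc (1 / n : ℝ) (2 / n)
    · rw [indicator_of_mem hmem, norm_mul]
      have h1 : ‖P t‖ ≤ ε / (M + 1) := by
        have := hPδ t (Ioo_subset_Icc_self ht) (by
          rw [Real.dist_eq, sub_zero, abs_of_pos ht.1]
          exact hmem.2.trans_lt ((div_lt_iff₀ hn0).2 (by linarith)))
        rw [hP0, dist_zero_right] at this
        exact this.le
      have h2 : ‖n * deriv Real.smoothTransition (n * t - 1) * w n t‖ ≤ n * M := by
        rw [norm_mul, norm_mul, Real.norm_eq_abs, Real.norm_eq_abs, Real.norm_eq_abs,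
          abs_of_pos hn0]
        calc _ ≤ n * M * 1 := by
              gcongr
              · exact hM _
              · exact hw n t
          _ = n * M := mul_one _
      gcongr
    · rw [indicator_of_notMem hmem, deriv_smoothTransition_eq_zero]
      · simp
      · contrapose hmem
        rw [mem_Icc] at hmem ⊢
        rw [div_le_iff₀ hn0, le_div_iff₀ hn0]
        constructor <;> linarith [hmem.1, hmem.2]
  have hint : Integrable ((Icc (1 / n : ℝ) (2 / n)).indicator fun _ => ε / (M + 1) * (n * M)) :=
    (integrable_indicator_iff measurableSet_Icc).2 (integrableOn_const (by simp))
  rw [dist_zero_right]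
  calc _ ≤ ∫ t in Ioo 0 T, (Icc (1 / n : ℝ) (2 / n)).indicator
            (fun _ => ε / (M + 1) * (n * M)) t :=
        norm_integral_le_of_norm_le hint.integrableOn
          ((ae_restrict_iff' measurableSet_Ioo).2 (ae_of_all _ hbd))
    _ ≤ ∫ t, (Icc (1 / n : ℝ) (2 / n)).indicator (fun _ => ε / (M + 1) * (n * M)) t :=
        setIntegral_le_integral hint
          (ae_of_all _ fun t => indicator_nonneg (fun _ _ => by positivity) t)
    _ = ε * (M / (M + 1)) := by
        rw [integral_indicator measurableSet_Icc, setIntegral_const, Real.volume_real_Icc_of_le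
          (by gcongr; norm_num), smul_eq_mul]
        field_simp
        ring
    _ < ε := by
        have : M / (M + 1) < 1 := by rw [div_lt_one (by linarith)]; linarith
        nlinarith

/-- A cutoff of `(0,T)` which tends to `1` as `n → ∞`. -/
def cutoff (T : ℝ) (n : ℕ) (t : ℝ) : ℝ :=
  Real.smoothTransition (n * t - 1) * Real.smoothTransition (n * (T - t) - 1)

theorem contDiff_cutoff (n : ℕ) : ContDiff ℝ ∞ (cutoff T n) := by
  unfold cutoff
  exact (Real.smoothTransition.contDiff.comp (by fun_prop)).mul
    (Real.smoothTransition.contDiff.comp (by fun_prop))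

theorem abs_smoothTransition_le_one (x : ℝ) : |Real.smoothTransition x| ≤ 1 := by
  rw [abs_of_nonneg (Real.smoothTransition.nonneg x)]; exact Real.smoothTransition.le_one x

theorem abs_cutoff_le_one (n : ℕ) (t : ℝ) : |cutoff T n t| ≤ 1 := by
  rw [cutoff, abs_mul]
  exact mul_le_one₀ (abs_smoothTransition_le_one _) (abs_nonneg _) (abs_smoothTransition_le_one _)

theorem cutoff_eq_zero {n : ℕ} {t : ℝ} (ht : t ∉ Icc (1 / n : ℝ) (T - 1 / n)) :
    cutoff T n t = 0 := by
  -- For `n = 0` the division convention makes the interval `[0, T]`, but the cutoff vanishes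
  -- identically.
  rcases Nat.eq_zero_or_pos n with rfl | hn
  · simp [cutoff, Real.smoothTransition.zero_of_nonpos]
  have hn0 : (0 : ℝ) < n := by exact_mod_cast hn
  rw [mem_Icc, not_and_or, not_le, not_le] at ht
  rcases ht with ht | ht
  · rw [cutoff, Real.smoothTransition.zero_of_nonpos, zero_mul]
    rw [lt_div_iff₀ hn0] at ht; linarith
  · rw [cutoff, mul_comm, Real.smoothTransition.zero_of_nonpos, zero_mul]
    have : T - t < 1 / n := by linarith
    rw [lt_div_iff₀ hn0] at this; linarith

theorem tendsto_cutoff {t : ℝ} (ht : t ∈ Ioo 0 T) :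
    Tendsto (fun n => cutoff T n t) atTop (𝓝 1) := by
  have h : ∀ {s : ℝ}, 0 < s → ∀ᶠ n : ℕ in atTop, Real.smoothTransition (n * s - 1) = 1 := by
    intro s hs
    obtain ⟨N, hN⟩ := exists_nat_gt (2 / s)
    filter_upwards [eventually_ge_atTop N] with n hn
    apply Real.smoothTransition.one_of_one_le
    have : (N : ℝ) ≤ n := by exact_mod_cast hn
    rw [div_lt_iff₀ hs] at hN
    nlinarith
  refine tendsto_const_nhds.congr' ?_
  filter_upwards [h ht.1, h (sub_pos.2 ht.2)] with n h1 h2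
  rw [cutoff, h1, h2, one_mul]

theorem isTest_mul_cutoff {θ : ℝ → ℝ} (hθ : ContDiff ℝ ∞ θ) {n : ℕ} (hn : 0 < n) :
    IsTest (Ioo 0 T) (fun t => θ t * cutoff T n t) := by
  have hn0 : (0 : ℝ) < 1 / n := by positivity
  have hs : tsupport (fun t => θ t * cutoff T n t) ⊆ Icc (1 / n : ℝ) (T - 1 / n) := by
    refine closure_minimal (fun t ht => ?_) isClosed_Icc
    by_contra hc
    exact ht (by simp only [cutoff_eq_zero hc, mul_zero])
  exact ⟨hθ.mul (contDiff_cutoff n), isCompact_Icc.of_isClosed_subset (isClosed_tsupport _) hs,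
    hs.trans (fun t ht => ⟨hn0.trans_le ht.1, by linarith [ht.2]⟩)⟩

theorem hasDerivAt_cutoff (n : ℕ) (t : ℝ) :
    HasDerivAt (cutoff T n)
      (n * deriv Real.smoothTransition (n * t - 1) * Real.smoothTransition (n * (T - t) - 1)
        - n * deriv Real.smoothTransition (n * (T - t) - 1) * Real.smoothTransition (n * t - 1))
      t := by
  have hS : ∀ x, HasDerivAt Real.smoothTransition (deriv Real.smoothTransition x) x := fun x =>
    ((Real.smoothTransition.contDiff (n := 1)).differentiable one_ne_zero x).hasDerivAt
  have h1 : HasDerivAt (fun t : ℝ => (n : ℝ) * t - 1) n t := by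
    simpa using ((hasDerivAt_id t).const_mul (n : ℝ)).sub_const 1
  have h2 : HasDerivAt (fun t : ℝ => (n : ℝ) * (T - t) - 1) (-n) t := by
    simpa using (((hasDerivAt_id t).const_sub T).const_mul (n : ℝ)).sub_const 1
  convert! ((hS _).comp t h1).mul ((hS _).comp t h2) using 1
  simp only [Function.comp]
  ring

theorem integral_reflect (hT : 0 < T) (f : ℝ → ℝ) :
    ∫ t in Ioo 0 T, f (T - t) = ∫ t in Ioo 0 T, f t := by
  have := intervalIntegral.integral_comp_sub_left f (a := 0) (b := T) T
  rwa [sub_self, sub_zero, intervalIntegral.integral_of_le hT.le,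
    intervalIntegral.integral_of_le hT.le, integral_Ioc_eq_integral_Ioo,
    integral_Ioc_eq_integral_Ioo] at this

theorem integrableOn_Ioo_mul {P Φ : ℝ → ℝ} (hP : ContinuousOn P (Icc 0 T))
    (hΦ : Continuous Φ) : IntegrableOn (fun t => P t * Φ t) (Ioo 0 T) :=
  ((hP.mul hΦ.continuousOn).integrableOn_Icc).mono_set Ioo_subset_Icc_self

/-- The cutoff vanishes at both ends, so its derivative has integral zero and `P` may be replaced by
`P - P 0`. By periodicity this difference vanishes at `0` and at `T`, and the two boundary layers
are negligible separately. -/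
theorem tendsto_integral_deriv_cutoff {P : ℝ → ℝ} (hT : 0 < T) (hP : ContinuousOn P (Icc 0 T))
    (hper : P 0 = P T) :
    Tendsto (fun n : ℕ => ∫ t in Ioo 0 T, P t * deriv (cutoff T n) t) atTop (𝓝 0) := by
  have hdc : ∀ n, Continuous (deriv (cutoff T n)) := fun n =>
    (contDiff_cutoff n).continuous_deriv (by simp)
  have hSd : Continuous (deriv Real.smoothTransition) :=
    (Real.smoothTransition.contDiff (n := 1)).continuous_deriv le_rfl
  have hS : Continuous Real.smoothTransition := Real.smoothTransition.continuous
  set P₀ : ℝ → ℝ := fun t => P t - P 0 with hP₀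
  have hP₀c : ContinuousOn P₀ (Icc 0 T) := hP.sub continuousOn_const
  have hmaps : MapsTo (fun t => T - t) (Icc 0 T) (Icc 0 T) :=
    fun t ht => ⟨by linarith [ht.2], by linarith [ht.1]⟩
  have hP₁c : ContinuousOn (fun t => P₀ (T - t)) (Icc 0 T) :=
    hP₀c.comp (by fun_prop) hmaps
  have h1 := tendsto_integral_boundary_layer hT hP₀c (by simp [hP₀])
    (w := fun n t => Real.smoothTransition (n * (T - t) - 1))
    (fun n t => abs_smoothTransition_le_one _)
  have h2 := tendsto_integral_boundary_layer hT hP₁c (by simp [hP₀, hper])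
    (w := fun n t => Real.smoothTransition (n * (T - t) - 1))
    (fun n t => abs_smoothTransition_le_one _)
  have h := h1.sub h2
  rw [sub_zero] at h
  refine h.congr fun n => ?_
  -- The layer at `T` is carried to `0` by `t ↦ T - t`, where `h2` applies.
  have hr := integral_reflect hT (fun t => P₀ t *
    (n * deriv Real.smoothTransition (n * (T - t) - 1) * Real.smoothTransition (n * t - 1)))
  simp only [sub_sub_cancel] at hr
  rw [hr, ← integral_sub (integrableOn_Ioo_mul hP₀c (by fun_prop))
    (integrableOn_Ioo_mul hP₀c (by fun_prop))]
  have hz : ∫ t in Ioo 0 T, deriv (cutoff T n) t = 0 := by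
    rw [← integral_Ioc_eq_integral_Ioo, ← intervalIntegral.integral_of_le hT.le,
      intervalIntegral.integral_deriv_eq_sub
        (fun t _ => (hasDerivAt_cutoff n t).differentiableAt) ((hdc n).intervalIntegrable _ _)]
    simp [cutoff, Real.smoothTransition.zero_of_nonpos]
  have e : ∫ t in Ioo 0 T, P t * deriv (cutoff T n) t
      = ∫ t in Ioo 0 T, (P₀ t * deriv (cutoff T n) t + P 0 * deriv (cutoff T n) t) := by
    congr with t; simp only [hP₀]; ring
  rw [e, integral_add (integrableOn_Ioo_mul hP₀c (hdc n))
    (integrableOn_Ioo_mul (continuousOn_const (c := P 0)) (hdc n)), integral_const_mul, hz, mul_zero,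
    add_zero]
  congr with t
  rw [(hasDerivAt_cutoff n t).deriv]
  ring

theorem tendsto_integral_mul_cutoff {f : ℝ → ℝ} (hf : IntegrableOn f (Ioo 0 T)) :
    Tendsto (fun n : ℕ => ∫ t in Ioo 0 T, f t * cutoff T n t) atTop
      (𝓝 (∫ t in Ioo 0 T, f t)) := by
  refine tendsto_integral_of_dominated_convergence (fun t => ‖f t‖)
    (fun n => hf.aestronglyMeasurable.mul
      (contDiff_cutoff n).continuous.aestronglyMeasurable) hf.norm
    (fun n => ae_of_all _ fun t => ?_)
    ((ae_restrict_iff' measurableSet_Ioo).2 (ae_of_all _ fun t ht => ?_))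
  · rw [norm_mul]
    exact mul_le_of_le_one_right (norm_nonneg _) (abs_cutoff_le_one n t)
  · simpa using (tendsto_cutoff ht).const_mul (f t)

/-- A weak derivative of a continuous function with equal end values can be tested with smooth
functions with equal end values. -/
theorem integral_mul_deriv_of_periodic {F G θ : ℝ → ℝ} (hT : 0 < T)
    (hF : ContinuousOn F (Icc 0 T)) (hper : F 0 = F T) (hG : IntegrableOn G (Ioo 0 T))
    (hFG : ∀ χ : ℝ → ℝ, IsTest (Ioo 0 T) χ →
      ∫ t in Ioo 0 T, F t * deriv χ t = - ∫ t in Ioo 0 T, G t * χ t)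
    (hθ : ContDiff ℝ ∞ θ) (hθper : θ 0 = θ T) :
    ∫ t in Ioo 0 T, F t * deriv θ t = - ∫ t in Ioo 0 T, G t * θ t := by
  have hθd : Continuous (deriv θ) := hθ.continuous_deriv (by simp)
  have hPc : ContinuousOn (fun t => F t * θ t) (Icc 0 T) := hF.mul hθ.continuous.continuousOn
  have hFi : IntegrableOn (fun t => F t * deriv θ t) (Ioo 0 T) := integrableOn_Ioo_mul hF hθd
  obtain ⟨C, hC⟩ := (isCompact_Icc (a := 0) (b := T)).exists_bound_of_continuousOn
    hθ.continuous.continuousOn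
  have hGi : IntegrableOn (fun t => G t * θ t) (Ioo 0 T) :=
    Integrable.mul_bdd (c := C) hG hθ.continuous.aestronglyMeasurable
      ((ae_restrict_iff' measurableSet_Ioo).2
        (ae_of_all _ fun t ht => hC t (Ioo_subset_Icc_self ht)))
  -- These are the two terms of the product rule for `θ` times the cutoff; the second disappears in
  -- the limit because `F θ` takes equal values at the ends.
  have l1 := (tendsto_integral_mul_cutoff hFi).add
    (tendsto_integral_deriv_cutoff hT hPc (by simp only [hper, hθper]))
  have l2 := (tendsto_integral_mul_cutoff hGi).neg
  rw [add_zero] at l1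
  refine tendsto_nhds_unique (l1.congr' ?_) l2
  filter_upwards [eventually_gt_atTop 0] with n hn
  have hdc : Continuous (deriv (cutoff T n)) := (contDiff_cutoff n).continuous_deriv (by simp)
  have h := hFG _ (isTest_mul_cutoff hθ hn)
  rw [← integral_add
    (integrableOn_Ioo_mul (P := fun t => F t * deriv θ t) (hF.mul hθd.continuousOn)
      (contDiff_cutoff n).continuous)
    (integrableOn_Ioo_mul hPc hdc)]
  simp only [mul_assoc]
  rw [← h]
  congr with t
  rw [deriv_fun_mul (hθ.differentiable (by simp) t) (hasDerivAt_cutoff n t).differentiableAt]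
  ring

end

/-! ### Weak time derivatives on the cylinder, at almost every point of `Ω` -/

section
variable {d : ℕ} {Ω : Set (Sp d)} {T : ℝ}

theorem muQ_eq_prod (Ω : Set (Sp d)) (T : ℝ) :
    muQ Ω T = (muOmega Ω).prod (volume.restrict (Ioo 0 T)) := by
  rw [muQ, Measure.volume_eq_prod, Measure.prod_restrict]

theorem isFiniteMeasure_muOmega (hΩ : Bornology.IsBounded Ω) : IsFiniteMeasure (muOmega Ω) :=
  ⟨by simpa using hΩ.measure_lt_top⟩

theorem isFiniteMeasure_muQ (hΩ : Bornology.IsBounded Ω) (T : ℝ) : IsFiniteMeasure (muQ Ω T) := by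
  have := isFiniteMeasure_muOmega hΩ
  rw [muQ_eq_prod]
  infer_instance

theorem ae_memLp_two_slice_right {α β E : Type*} [MeasurableSpace α] [MeasurableSpace β]
    [NormedAddCommGroup E] {μ : Measure α} {ν : Measure β} [SFinite μ] [SFinite ν]
    {u : α × β → E} (hu : MemLp u 2 (μ.prod ν)) :
    ∀ᵐ x ∂μ, MemLp (fun t => u (x, t)) 2 ν := by
  filter_upwards [hu.1.prodMk_left, (hu.integrable_norm_pow two_ne_zero).prod_right_ae]
    with x h1 h2
  exact (memLp_two_iff_integrable_sq_norm h1).2 h2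

theorem ae_memLp_two_slice_left {α β E : Type*} [MeasurableSpace α] [MeasurableSpace β]
    [NormedAddCommGroup E] {μ : Measure α} {ν : Measure β} [SFinite μ] [SFinite ν]
    {u : α × β → E} (hu : MemLp u 2 (μ.prod ν)) :
    ∀ᵐ t ∂ν, MemLp (fun x => u (x, t)) 2 μ :=
  ae_memLp_two_slice_right (hu.comp_measurePreserving Measure.measurePreserving_swap)

theorem IsTest.memLp {F : Type*} [NormedAddCommGroup F] [NormedSpace ℝ F] [MeasurableSpace F]
    [OpensMeasurableSpace F] [SecondCountableTopology F] {μ : Measure F} [IsFiniteMeasure μ]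
    {U : Set F} {φ : F → ℝ} (hφ : IsTest U φ) (p : ℝ≥0∞) :
    MemLp φ p μ := by
  obtain ⟨C, hC⟩ := hφ.smooth.continuous.bounded_above_of_compact_support hφ.compact_support
  exact MemLp.of_bound hφ.smooth.continuous.aestronglyMeasurable C (ae_of_all _ hC)

theorem IsTest.mul_prod {ψ : Sp d → ℝ} {χ : ℝ → ℝ} {I : Set ℝ} (hψ : IsTest Ω ψ)
    (hχ : IsTest I χ) : IsTest (Ω ×ˢ I) (fun z : Sp d × ℝ => ψ z.1 * χ z.2) := by
  have hs : tsupport (fun z : Sp d × ℝ => ψ z.1 * χ z.2) ⊆ tsupport ψ ×ˢ tsupport χ := by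
    refine closure_minimal (fun z hz => ?_) ((isClosed_tsupport _).prod (isClosed_tsupport _))
    exact ⟨subset_tsupport _ fun h => hz (by simp [h]), subset_tsupport _ fun h => hz (by simp [h])⟩
  exact ⟨(hψ.smooth.comp contDiff_fst).mul (hχ.smooth.comp contDiff_snd),
    (hψ.compact_support.isCompact.prod hχ.compact_support.isCompact).of_isClosed_subset
      (isClosed_tsupport _) hs,
    hs.trans (prod_mono hψ.support_subset hχ.support_subset)⟩

theorem integrable_mul_snd {u : Sp d × ℝ → ℝ} (hu : Integrable u (muQ Ω T)) {Φ : ℝ → ℝ}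
    (hΦ : Continuous Φ) : Integrable (fun z => u z * Φ z.2) (muQ Ω T) := by
  obtain ⟨C, hC⟩ := (isCompact_Icc (a := 0) (b := T)).exists_bound_of_continuousOn
    hΦ.continuousOn
  refine hu.mul_bdd (c := C) (hΦ.comp continuous_snd).aestronglyMeasurable ?_
  have : ∀ᵐ z ∂(muQ Ω T), z.2 ∈ Ioo 0 T := by
    rw [muQ_eq_prod]
    exact Measure.quasiMeasurePreserving_snd.ae (ae_restrict_mem measurableSet_Ioo)
  filter_upwards [this] with z hz
  exact hC _ (Ioo_subset_Icc_self hz)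

theorem integral_mul_prod {u : Sp d × ℝ → ℝ} {ψ : Sp d → ℝ} {Φ : ℝ → ℝ}
    (hi : Integrable (fun z => u z * (ψ z.1 * Φ z.2)) (muQ Ω T)) :
    ∫ z, u z * (ψ z.1 * Φ z.2) ∂(muQ Ω T)
      = ∫ t in Ioo 0 T, (∫ x, u (x, t) * ψ x ∂(muOmega Ω)) * Φ t := by
  rw [muQ_eq_prod] at hi ⊢
  rw [integral_prod_symm _ hi]
  congr with t
  rw [← integral_mul_const]
  congr with x
  ring

theorem integral_mul_prod' {u : Sp d × ℝ → ℝ} {ψ : Sp d → ℝ} {Φ : ℝ → ℝ}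
    (hi : Integrable (fun z => u z * (ψ z.1 * Φ z.2)) (muQ Ω T)) :
    ∫ z, u z * (ψ z.1 * Φ z.2) ∂(muQ Ω T)
      = ∫ x, ψ x * (∫ t in Ioo 0 T, u (x, t) * Φ t) ∂(muOmega Ω) := by
  rw [muQ_eq_prod] at hi ⊢
  rw [integral_prod _ hi]
  congr with x
  rw [← integral_const_mul]
  congr with t
  ring

theorem integrable_mul_prod {u : Sp d × ℝ → ℝ}
    (hu : Integrable u (muQ Ω T)) {ψ : Sp d → ℝ} {Φ : ℝ → ℝ} (hψ : IsTest Ω ψ)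
    (hΦ : Continuous Φ) :
    Integrable (fun z => u z * (ψ z.1 * Φ z.2)) (muQ Ω T) := by
  obtain ⟨C, hC⟩ := hψ.smooth.continuous.bounded_above_of_compact_support hψ.compact_support
  have := (integrable_mul_snd hu hΦ).mul_bdd (c := C) (g := fun z => ψ z.1)
    (hψ.smooth.continuous.comp continuous_fst).aestronglyMeasurable (ae_of_all _ fun z => hC _)
  refine this.congr (ae_of_all _ fun z => ?_)
  simp only
  ring

/-- The weak time derivative of a time-periodic function can be tested, at almost every point of
`Ω`, with smooth functions of time with equal end values. -/
theorem ae_integral_weakTimeDeriv_mul (hΩo : IsOpen Ω) (hΩ : Bornology.IsBounded Ω) (hT : 0 < T)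
    {u g : Sp d × ℝ → ℝ} (hu : MemLp u 2 (muQ Ω T)) (hg : MemLp g 2 (muQ Ω T))
    (hug : IsWeakTimeDeriv Ω T u g) (hper : IsTimePeriodic Ω T u)
    {θ : ℝ → ℝ} (hθ : ContDiff ℝ ∞ θ) (hθper : θ 0 = θ T) :
    ∀ᵐ x ∂(muOmega Ω), ∫ t in Ioo 0 T, u (x, t) * deriv θ t
      = - ∫ t in Ioo 0 T, g (x, t) * θ t := by
  have := isFiniteMeasure_muOmega hΩ
  have := isFiniteMeasure_muQ hΩ T
  have hui : Integrable u (muQ Ω T) := hu.integrable (by norm_num)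
  have hgi : Integrable g (muQ Ω T) := hg.integrable (by norm_num)
  have hθd : Continuous (deriv θ) := hθ.continuous_deriv (by simp)
  obtain ⟨U, hUc, hUae, hU0⟩ := hper
  have key : ∀ ψ : Sp d → ℝ, IsTest Ω ψ →
      ∫ x, ψ x * (∫ t in Ioo 0 T, u (x, t) * deriv θ t) ∂(muOmega Ω)
        = - ∫ x, ψ x * (∫ t in Ioo 0 T, g (x, t) * θ t) ∂(muOmega Ω) := by
    intro ψ hψ
    rw [← integral_mul_prod' (integrable_mul_prod hui hψ hθd),
      ← integral_mul_prod' (integrable_mul_prod hgi hψ hθ.continuous),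
      integral_mul_prod (integrable_mul_prod hui hψ hθd),
      integral_mul_prod (integrable_mul_prod hgi hψ hθ.continuous)]
    have hψL : MemLp ψ 2 (muOmega Ω) := hψ.memLp 2
    -- Pairing the continuous representative with `ψ` reduces the claim to a continuous scalar
    -- function with equal end values, which is the one-dimensional case.
    set F : ℝ → ℝ := fun t => inner ℝ hψL.toLp (U t) with hF
    have hFae : ∀ᵐ t ∂(volume.restrict (Ioo 0 T)),
        ∫ x, u (x, t) * ψ x ∂(muOmega Ω) = F t := by
      filter_upwards [hUae] with t ht
      rw [hF]
      simp only
      rw [L2.inner_def]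
      refine integral_congr_ae ?_
      filter_upwards [ht, hψL.coeFn_toLp] with x h1 h2
      rw [h1, h2]
      simp
    have hFint : ∀ Φ : ℝ → ℝ, ∫ t in Ioo 0 T, (∫ x, u (x, t) * ψ x ∂(muOmega Ω)) * Φ t
        = ∫ t in Ioo 0 T, F t * Φ t := fun Φ => by
      refine integral_congr_ae ?_
      filter_upwards [hFae] with t ht
      rw [ht]
    rw [hFint]
    refine integral_mul_deriv_of_periodic hT ?_ ?_ ?_ ?_ hθ hθper
    · exact (innerSL ℝ hψL.toLp).continuous.comp_continuousOn hUc
    · simp only [hF, hU0]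
    · have h := integrable_mul_prod (T := T) hgi hψ (continuous_const (y := (1 : ℝ)))
      rw [muQ_eq_prod] at h
      simpa [IntegrableOn] using h.integral_prod_right
    · intro χ hχ
      have hχd : Continuous (deriv χ) := hχ.smooth.continuous_deriv (by simp)
      rw [← hFint, ← integral_mul_prod (integrable_mul_prod hui hψ hχd),
        ← integral_mul_prod (integrable_mul_prod hgi hψ hχ.smooth.continuous),
        ← hug _ (hψ.mul_prod hχ)]
      simp only [deriv_const_mul_field]
  have hAi : ∀ {v : Sp d × ℝ → ℝ} {Φ : ℝ → ℝ}, Integrable v (muQ Ω T) → Continuous Φ →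
      Integrable (fun x => ∫ t in Ioo 0 T, v (x, t) * Φ t) (muOmega Ω) := by
    intro v Φ hv hΦ
    have h := integrable_mul_snd hv hΦ
    rw [muQ_eq_prod] at h
    exact h.integral_prod_left
  have hA := hAi hui hθd
  have hB := hAi hgi hθ.continuous
  -- Fundamental lemma of the calculus of variations in `x`: the identity against every `ψ` becomes
  -- an identity almost everywhere.
  have h0 := hΩo.ae_eq_zero_of_integral_contDiff_smul_eq_zero (μ := volume)
    (f := fun x => (∫ t in Ioo 0 T, u (x, t) * deriv θ t) + ∫ t in Ioo 0 T, g (x, t) * θ t)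
    (IntegrableOn.locallyIntegrableOn (hA.add hB)) (fun ψ h1 h2 h3 => by
      have hψ : IsTest Ω ψ := ⟨h1, h2, h3⟩
      obtain ⟨C, hC⟩ := h1.continuous.bounded_above_of_compact_support h2
      have hm : ∀ {f : Sp d → ℝ}, Integrable f (muOmega Ω) →
          Integrable (fun x => ψ x * f x) (muOmega Ω) := fun hf =>
        hf.bdd_mul (c := C) h1.continuous.aestronglyMeasurable (ae_of_all _ hC)
      rw [← setIntegral_eq_integral_of_forall_compl_eq_zero (s := Ω) (fun x hx => by
        rw [image_eq_zero_of_notMem_tsupport (fun h => hx (h3 h)), zero_smul])]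
      simp only [smul_eq_mul, mul_add]
      rw [integral_add (hm hA) (hm hB), key ψ hψ, neg_add_cancel])
  rw [ae_restrict_iff' hΩo.measurableSet]
  filter_upwards [h0] with x hx hxΩ
  exact eq_neg_of_add_eq_zero_left (hx hxΩ)

end

/-! ### Fourier coefficients on `Q` and the half-order time form -/

section
variable {d : ℕ} {Ω : Set (Sp d)} {T : ℝ}

theorem ae_memLp_time {u : Sp d × ℝ → ℝ} (hu : MemLp u 2 (muQ Ω T)) :
    ∀ᵐ x ∂(muOmega Ω), MemLp (fun t => u (x, t)) 2 (volume.restrict (Ioo 0 T)) := by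
  rw [muQ_eq_prod] at hu
  exact ae_memLp_two_slice_right hu

theorem ae_memLp_space {E : Type*} [NormedAddCommGroup E] {u : Sp d × ℝ → E}
    (hu : MemLp u 2 (muQ Ω T)) :
    ∀ᵐ t ∂(volume.restrict (Ioo 0 T)), MemLp (fun x => u (x, t)) 2 (muOmega Ω) := by
  rw [muQ_eq_prod] at hu
  exact ae_memLp_two_slice_left hu

theorem coefCos_eq (u : Sp d × ℝ → ℝ) (k : ℕ) (x : Sp d) :
    coefCos T u k x = cosCoef T (fun t => u (x, t)) k := rfl

theorem coefSin_eq (u : Sp d × ℝ → ℝ) (k : ℕ) (x : Sp d) :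
    coefSin T u k x = sinCoef T (fun t => u (x, t)) k := rfl

theorem aestronglyMeasurable_coefCos {u : Sp d × ℝ → ℝ}
    (hu : AEStronglyMeasurable u (muQ Ω T)) (k : ℕ) :
    AEStronglyMeasurable (coefCos T u k) (muOmega Ω) := by
  rw [muQ_eq_prod] at hu
  exact ((hu.mul (by fun_prop : Continuous fun z : Sp d × ℝ =>
    Real.cos (k * freq T * z.2)).aestronglyMeasurable).integral_prod_right').const_mul _

theorem aestronglyMeasurable_coefSin {u : Sp d × ℝ → ℝ}
    (hu : AEStronglyMeasurable u (muQ Ω T)) (k : ℕ) :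
    AEStronglyMeasurable (coefSin T u k) (muOmega Ω) := by
  rw [muQ_eq_prod] at hu
  exact ((hu.mul (by fun_prop : Continuous fun z : Sp d × ℝ =>
    Real.sin (k * freq T * z.2)).aestronglyMeasurable).integral_prod_right').const_mul _

/-- Each term is bounded by the Parseval sum. Its extra term is half the term at `k = 0`, which can
be absorbed at the price of doubling `2/T` to `4/T`. -/
theorem sq_coef_le (hT : 0 < T) {f : ℝ → ℝ} (hf : MemLp f 2 (volume.restrict (Ioo 0 T)))
    (k : ℕ) : cosCoef T f k ^ 2 + sinCoef T f k ^ 2 ≤ 4 / T * ∫ t in Ioo 0 T, f t ^ 2 := by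
  have h := hasSum_sq_coef hT hf
  have hk := fun k => le_hasSum h k (fun j _ => by positivity)
  have h0 := hk 0
  have hk := hk k
  have e : 4 / T * ∫ t in Ioo 0 T, f t ^ 2 = 2 * (2 / T * ∫ t in Ioo 0 T, f t ^ 2) := by ring
  rw [e]
  rw [sinCoef_zero] at h0
  linarith

theorem integrable_integral_sq {u : Sp d × ℝ → ℝ} (hu : MemLp u 2 (muQ Ω T)) :
    Integrable (fun x => ∫ t in Ioo 0 T, u (x, t) ^ 2) (muOmega Ω) := by
  have h := hu.integrable_sq
  rw [muQ_eq_prod] at h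
  exact h.integral_prod_left

theorem memLp_coefCos (hT : 0 < T) {u : Sp d × ℝ → ℝ} (hu : MemLp u 2 (muQ Ω T)) (k : ℕ) :
    MemLp (coefCos T u k) 2 (muOmega Ω) := by
  have hm := aestronglyMeasurable_coefCos hu.1 k
  refine (memLp_two_iff_integrable_sq hm).2
    (((integrable_integral_sq hu).const_mul (4 / T)).mono' (hm.pow 2) ?_)
  filter_upwards [ae_memLp_time hu] with x hx
  rw [Real.norm_of_nonneg (sq_nonneg _)]
  have := sq_coef_le hT hx k
  rw [coefCos_eq]
  linarith [sq_nonneg (sinCoef T (fun t => u (x, t)) k)]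

theorem memLp_coefSin (hT : 0 < T) {u : Sp d × ℝ → ℝ} (hu : MemLp u 2 (muQ Ω T)) (k : ℕ) :
    MemLp (coefSin T u k) 2 (muOmega Ω) := by
  have hm := aestronglyMeasurable_coefSin hu.1 k
  refine (memLp_two_iff_integrable_sq hm).2
    (((integrable_integral_sq hu).const_mul (4 / T)).mono' (hm.pow 2) ?_)
  filter_upwards [ae_memLp_time hu] with x hx
  rw [Real.norm_of_nonneg (sq_nonneg _)]
  have := sq_coef_le hT hx k
  rw [coefSin_eq]
  linarith [sq_nonneg (cosCoef T (fun t => u (x, t)) k)]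

theorem integrable_sq_coef (hT : 0 < T) {u : Sp d × ℝ → ℝ} (hu : MemLp u 2 (muQ Ω T)) (k : ℕ) :
    Integrable (fun x => coefCos T u k x ^ 2 + coefSin T u k x ^ 2) (muOmega Ω) :=
  (memLp_coefCos hT hu k).integrable_sq.add (memLp_coefSin hT hu k).integrable_sq

theorem ae_summable_sq_coef (hT : 0 < T) {u : Sp d × ℝ → ℝ} (hu : MemLp u 2 (muQ Ω T)) :
    ∀ᵐ x ∂(muOmega Ω), Summable fun k => coefCos T u k x ^ 2 + coefSin T u k x ^ 2 := by
  filter_upwards [ae_memLp_time hu] with x hx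
  exact (hasSum_sq_coef hT hx).summable

theorem integrable_tsum_sq_coef (hT : 0 < T) {u : Sp d × ℝ → ℝ} (hu : MemLp u 2 (muQ Ω T)) :
    Integrable (fun x => ∑' k, (coefCos T u k x ^ 2 + coefSin T u k x ^ 2)) (muOmega Ω) := by
  refine (((integrable_integral_sq hu).const_mul (2 / T)).add
    ((memLp_coefCos hT hu 0).integrable_sq.const_mul (1 / 2))).congr ?_
  filter_upwards [ae_memLp_time hu] with x hx
  exact (hasSum_sq_coef hT hx).tsum_eq.symm

theorem summable_integral_sq_coef (hT : 0 < T) {u : Sp d × ℝ → ℝ} (hu : MemLp u 2 (muQ Ω T)) :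
    Summable fun k => ∫ x, (coefCos T u k x ^ 2 + coefSin T u k x ^ 2) ∂(muOmega Ω) := by
  refine (hasSum_integral_of_dominated_convergence
    (f := fun x => ∑' k, (coefCos T u k x ^ 2 + coefSin T u k x ^ 2))
    (fun k x => coefCos T u k x ^ 2 + coefSin T u k x ^ 2)
    (fun k => (integrable_sq_coef hT hu k).1) (fun k => ae_of_all _ fun x => ?_)
    (ae_summable_sq_coef hT hu) (integrable_tsum_sq_coef hT hu) ?_).summable
  · exact le_of_eq (Real.norm_of_nonneg (by positivity))
  · filter_upwards [ae_summable_sq_coef hT hu] with x hx using hx.hasSum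

/-- Parseval's identity in time, integrated over `Ω`. -/
theorem hasSum_integral_mul_coef (hT : 0 < T) {σ : Sp d → ℝ} {C : ℝ}
    (hσm : AEStronglyMeasurable σ (muOmega Ω)) (hσ : ∀ᵐ x ∂(muOmega Ω), |σ x| ≤ C)
    {f h : Sp d × ℝ → ℝ} (hf : MemLp f 2 (muQ Ω T)) (hh : MemLp h 2 (muQ Ω T))
    (hf0 : ∀ᵐ x ∂(muOmega Ω), coefCos T f 0 x = 0) :
    HasSum (fun k => ∫ x, σ x * (coefCos T f k x * coefCos T h k x
        + coefSin T f k x * coefSin T h k x) ∂(muOmega Ω))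
      (2 / T * ∫ z, σ z.1 * f z * h z ∂(muQ Ω T)) := by
  have hσQ : AEStronglyMeasurable (fun z : Sp d × ℝ => σ z.1) (muQ Ω T) := by
    rw [muQ_eq_prod]; exact hσm.comp_fst
  have hσb : ∀ᵐ z ∂(muQ Ω T), ‖σ z.1‖ ≤ C := by
    rw [muQ_eq_prod]
    exact Measure.quasiMeasurePreserving_fst.ae hσ
  have hi : Integrable (fun z => σ z.1 * f z * h z) (muQ Ω T) := by
    simpa only [mul_assoc, Pi.mul_apply] using (hf.integrable_mul hh).bdd_mul hσQ hσb
  have hI : 2 / T * ∫ z, σ z.1 * f z * h z ∂(muQ Ω T)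
      = ∫ x, σ x * (2 / T * ∫ t in Ioo 0 T, f (x, t) * h (x, t)) ∂(muOmega Ω) := by
    rw [muQ_eq_prod] at hi ⊢
    rw [integral_prod _ hi, ← integral_const_mul]
    congr with x
    simp only [mul_assoc]
    rw [integral_const_mul]
    ring
  rw [hI]
  -- Termwise domination by squared coefficients, whose sum over `k` is integrable over `Ω`, again
  -- by Parseval.
  refine hasSum_integral_of_dominated_convergence
    (fun k x => C / 2 * ((coefCos T f k x ^ 2 + coefSin T f k x ^ 2)
      + (coefCos T h k x ^ 2 + coefSin T h k x ^ 2)))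
    (fun k => hσm.mul (((aestronglyMeasurable_coefCos hf.1 k).mul
      (aestronglyMeasurable_coefCos hh.1 k)).add ((aestronglyMeasurable_coefSin hf.1 k).mul
      (aestronglyMeasurable_coefSin hh.1 k)))) (fun k => ?_) ?_ ?_ ?_
  · filter_upwards [hσ] with x hx
    rw [norm_mul, Real.norm_eq_abs, Real.norm_eq_abs]
    have hC : 0 ≤ C := (abs_nonneg _).trans hx
    calc _ ≤ C * (((coefCos T f k x ^ 2 + coefSin T f k x ^ 2)
            + (coefCos T h k x ^ 2 + coefSin T h k x ^ 2)) / 2) := by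
          gcongr
          rw [abs_le]
          constructor <;>
          nlinarith [sq_nonneg (coefCos T f k x + coefCos T h k x),
            sq_nonneg (coefCos T f k x - coefCos T h k x),
            sq_nonneg (coefSin T f k x + coefSin T h k x),
            sq_nonneg (coefSin T f k x - coefSin T h k x)]
      _ = _ := by ring
  · filter_upwards [ae_summable_sq_coef hT hf, ae_summable_sq_coef hT hh] with x h1 h2
    exact (h1.add h2).mul_left _
  · refine (((integrable_tsum_sq_coef hT hf).add
      (integrable_tsum_sq_coef hT hh)).const_mul (C / 2)).congr ?_
    filter_upwards [ae_summable_sq_coef hT hf, ae_summable_sq_coef hT hh] with x h1 h2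
    rw [tsum_mul_left, h1.tsum_add h2]
    rfl
  -- The zero time mean of `f` removes the extra term at `k = 0`.
  · filter_upwards [ae_memLp_time hf, ae_memLp_time hh, hf0] with x h1 h2 h3
    have := hasSum_mul_coef hT h1 h2
    rw [← coefCos_eq, h3, zero_mul, mul_zero, add_zero] at this
    exact this.mul_left _

theorem freq_pos (hT : 0 < T) : 0 < freq T := by unfold freq; positivity

theorem mul_freq_mul (hT : 0 < T) (k : ℕ) : k * freq T * T = k * (2 * Real.pi) := by
  unfold freq; field_simp

/-- The Fourier coefficients of the weak time derivative. -/
theorem ae_coef_dt (hΩo : IsOpen Ω) (hΩ : Bornology.IsBounded Ω) (hT : 0 < T)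
    (η : H11ZeroPer Ω T) (k : ℕ) :
    ∀ᵐ x ∂(muOmega Ω), coefCos T η.dt k x = k * freq T * coefSin T η.toFun k x ∧
      coefSin T η.dt k x = -(k * freq T * coefCos T η.toFun k x) := by
  have hlin : ∀ t : ℝ, HasDerivAt (fun t => k * freq T * t) (k * freq T) t := fun t => by
    simpa using (hasDerivAt_id t).const_mul (k * freq T)
  have hc := ae_integral_weakTimeDeriv_mul hΩo hΩ hT η.memLp η.memLp_dt η.isWeakTimeDeriv
    η.isTimePeriodic (θ := fun t => Real.cos (k * freq T * t))
    (Real.contDiff_cos.comp (by fun_prop)) (by simp [mul_freq_mul hT])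
  have hs := ae_integral_weakTimeDeriv_mul hΩo hΩ hT η.memLp η.memLp_dt η.isWeakTimeDeriv
    η.isTimePeriodic (θ := fun t => Real.sin (k * freq T * t))
    (Real.contDiff_sin.comp (by fun_prop)) (by
      simp only [mul_freq_mul hT, mul_zero, Real.sin_zero]
      have := Real.sin_nat_mul_pi (2 * k)
      push_cast at this
      rw [← this]; ring_nf)
  filter_upwards [hc, hs] with x h1 h2
  simp only [fun t => (hlin t).cos.deriv] at h1
  simp only [fun t => (hlin t).sin.deriv] at h2
  have e1 : ∫ t in Ioo 0 T, η.toFun (x, t) * (-Real.sin (k * freq T * t) * (k * freq T))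
      = -(k * freq T * ∫ t in Ioo 0 T, η.toFun (x, t) * Real.sin (k * freq T * t)) := by
    rw [← integral_const_mul, ← integral_neg]; congr with t; ring
  have e2 : ∫ t in Ioo 0 T, η.toFun (x, t) * (Real.cos (k * freq T * t) * (k * freq T))
      = k * freq T * ∫ t in Ioo 0 T, η.toFun (x, t) * Real.cos (k * freq T * t) := by
    rw [← integral_const_mul]; congr with t; ring
  rw [e1] at h1
  rw [e2] at h2
  unfold coefCos coefSin
  constructor
  · rw [← neg_inj.1 h1]; ring
  · rw [eq_neg_iff_add_eq_zero, mul_left_comm, h2]; ring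

/-- The coefficients of the derivative carry the weight `(k ω)²`, which dominates `ω · k ω` because
`k ≤ k²` on the naturals. -/
theorem summable_half_of_H11ZeroPer (hΩo : IsOpen Ω) (hΩ : Bornology.IsBounded Ω) (hT : 0 < T)
    (η : H11ZeroPer Ω T) :
    Summable fun k : ℕ => k * freq T *
      ∫ x, (coefCos T η.toFun k x ^ 2 + coefSin T η.toFun k x ^ 2) ∂(muOmega Ω) := by
  have hω := freq_pos hT
  refine Summable.of_nonneg_of_le (fun k => ?_) (fun k => ?_)
    ((summable_integral_sq_coef hT η.memLp_dt).mul_left (freq T)⁻¹)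
  · exact mul_nonneg (by positivity) (integral_nonneg fun x => by positivity)
  · have e : ∫ x, (coefCos T η.dt k x ^ 2 + coefSin T η.dt k x ^ 2) ∂(muOmega Ω)
        = (k * freq T) ^ 2 *
          ∫ x, (coefCos T η.toFun k x ^ 2 + coefSin T η.toFun k x ^ 2) ∂(muOmega Ω) := by
      rw [← integral_const_mul]
      refine integral_congr_ae ?_
      filter_upwards [ae_coef_dt hΩo hΩ hT η k] with x hx
      rw [hx.1, hx.2]; ring
    rw [e, ← mul_assoc]
    refine mul_le_mul_of_nonneg_right ?_ (integral_nonneg fun x => by positivity)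
    have hk : (k : ℝ) ≤ k ^ 2 := by exact_mod_cast Nat.le_self_pow two_ne_zero k
    have : (freq T)⁻¹ * (k * freq T) ^ 2 = k ^ 2 * freq T := by field_simp
    rw [this]
    gcongr

/-- For a function with weak time derivative, the form `⟨σ ∂_t^{1/2} η, ∂_t^{1/2} q^⊥⟩` is
`⟨σ ∂_t η, q⟩`. -/
theorem halfForm_eq_integral (hΩo : IsOpen Ω) (hΩ : Bornology.IsBounded Ω) (hT : 0 < T)
    {σ : Sp d → ℝ} {C : ℝ} (hσm : AEStronglyMeasurable σ (muOmega Ω))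
    (hσ : ∀ᵐ x ∂(muOmega Ω), |σ x| ≤ C) (η : H11ZeroPer Ω T) {q : Sp d × ℝ → ℝ}
    (hq : MemLp q 2 (muQ Ω T)) :
    halfForm Ω T σ η.toFun q = ∫ z, σ z.1 * η.dt z * q z ∂(muQ Ω T) := by
  have h := hasSum_integral_mul_coef hT hσm hσ η.memLp_dt hq (by
    filter_upwards [ae_coef_dt hΩo hΩ hT η 0] with x hx
    simpa using hx.1)
  have e : ∀ k : ℕ, k * freq T * ∫ x, σ x * (coefCos T η.toFun k x * (-coefSin T q k x)
        + coefSin T η.toFun k x * coefCos T q k x) ∂(muOmega Ω)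
      = ∫ x, σ x * (coefCos T η.dt k x * coefCos T q k x
        + coefSin T η.dt k x * coefSin T q k x) ∂(muOmega Ω) := by
    intro k
    rw [← integral_const_mul]
    refine integral_congr_ae ?_
    filter_upwards [ae_coef_dt hΩo hΩ hT η k] with x hx
    rw [hx.1, hx.2]; ring
  unfold halfForm
  simp_rw [e]
  rw [h.tsum_eq]
  field_simp

/-- Antisymmetry holds in each integrand, so no convergence is needed. It moves the time derivative
from the state, which need not have one, to `ζ`. -/
theorem halfForm_swap (Ω : Set (Sp d)) (T : ℝ) (σ : Sp d → ℝ) (y q : Sp d × ℝ → ℝ) :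
    halfForm Ω T σ y q = -halfForm Ω T σ q y := by
  unfold halfForm
  rw [← mul_neg, ← tsum_neg]
  congr 2 with k
  rw [← mul_neg, ← integral_neg]
  congr 2 with x
  ring

theorem ae_coef_sub {y v : Sp d × ℝ → ℝ}
    (hy : MemLp y 2 (muQ Ω T)) (hv : MemLp v 2 (muQ Ω T)) :
    ∀ᵐ x ∂(muOmega Ω), ∀ k,
      coefCos T (fun z => y z - v z) k x = coefCos T y k x - coefCos T v k x ∧
      coefSin T (fun z => y z - v z) k x = coefSin T y k x - coefSin T v k x := by
  filter_upwards [ae_memLp_time hy, ae_memLp_time hv] with x h1 h2 k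
  exact ⟨cosCoef_sub (integrableOn_of_memLp_two h1) (integrableOn_of_memLp_two h2) k,
    sinCoef_sub (integrableOn_of_memLp_two h1) (integrableOn_of_memLp_two h2) k⟩

/-- Adding the second argument to the first does not change the form. -/
theorem halfForm_sub_self {σ : Sp d → ℝ} {y v : Sp d × ℝ → ℝ}
    (hy : MemLp y 2 (muQ Ω T)) (hv : MemLp v 2 (muQ Ω T)) :
    halfForm Ω T σ y (fun z => y z - v z) = halfForm Ω T σ v (fun z => y z - v z) := by
  unfold halfForm
  congr 2 with k
  congr 1
  -- Termwise, the pairing of `y - v` with itself is zero, so neither linearity of the series nor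
  -- its summability is used.
  refine integral_congr_ae ?_
  filter_upwards [ae_coef_sub hy hv] with x hx
  rw [(hx k).1, (hx k).2]
  ring

/-! ### Differences and inclusions of the function spaces -/

theorem gradient_sub {φ ψ : Sp d → ℝ} {x : Sp d} (hφ : DifferentiableAt ℝ φ x)
    (hψ : DifferentiableAt ℝ ψ x) :
    gradient (fun x => φ x - ψ x) x = gradient φ x - gradient ψ x := by
  simp only [gradient]
  rw [fderiv_fun_sub hφ hψ, map_sub]

theorem IsTest.sub {F : Type*} [NormedAddCommGroup F] [NormedSpace ℝ F] {U : Set F}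
    {φ ψ : F → ℝ} (hφ : IsTest U φ) (hψ : IsTest U ψ) : IsTest U (fun x => φ x - ψ x) where
  smooth := hφ.smooth.sub hψ.smooth
  compact_support := hφ.compact_support.sub hψ.compact_support
  support_subset := (tsupport_sub φ ψ).trans
    (union_subset hφ.support_subset hψ.support_subset)

theorem IsTest.continuous_gradient {U : Set (Sp d)} {φ : Sp d → ℝ} (hφ : IsTest U φ) :
    Continuous (gradient φ) :=
  (InnerProductSpace.toDual ℝ (Sp d)).symm.continuous.comp (hφ.smooth.continuous_fderiv (by simp))

theorem tendsto_eLpNorm_sub_sub {α E : Type*} [MeasurableSpace α] [NormedAddCommGroup E]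
    {μ : Measure α} {a b : ℕ → α → E} {f g : α → E}
    (ha : ∀ n, AEStronglyMeasurable (a n) μ) (hb : ∀ n, AEStronglyMeasurable (b n) μ)
    (hf : AEStronglyMeasurable f μ) (hg : AEStronglyMeasurable g μ)
    (haf : Tendsto (fun n => eLpNorm (fun x => a n x - f x) 2 μ) atTop (𝓝 0))
    (hbg : Tendsto (fun n => eLpNorm (fun x => b n x - g x) 2 μ) atTop (𝓝 0)) :
    Tendsto (fun n => eLpNorm (fun x => (a n x - b n x) - (f x - g x)) 2 μ) atTop (𝓝 0) := by
  have h := haf.add hbg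
  rw [add_zero] at h
  refine tendsto_of_tendsto_of_tendsto_of_le_of_le tendsto_const_nhds h (fun _ => zero_le)
    fun n => ?_
  have e : (fun x => (a n x - b n x) - (f x - g x))
      = (fun x => a n x - f x) - fun x => b n x - g x := by
    ext x; simp only [Pi.sub_apply]; abel
  simp only [e]
  exact eLpNorm_sub_le ((ha n).sub hf) ((hb n).sub hg) (by norm_num)

theorem IsH1Zero.sub {w v : Sp d → ℝ} {g h : Sp d → Sp d} (hw : IsH1Zero Ω w g)
    (hv : IsH1Zero Ω v h) : IsH1Zero Ω (fun x => w x - v x) (fun x => g x - h x) := by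
  obtain ⟨φ, hφ, hφw, hφg⟩ := hw.approx
  obtain ⟨ψ, hψ, hψv, hψh⟩ := hv.approx
  refine ⟨hw.memLp.sub hv.memLp, hw.memLp_grad.sub hv.memLp_grad,
    fun n x => φ n x - ψ n x, fun n => (hφ n).sub (hψ n), ?_, ?_⟩
  · exact tendsto_eLpNorm_sub_sub (fun n => (hφ n).smooth.continuous.aestronglyMeasurable)
      (fun n => (hψ n).smooth.continuous.aestronglyMeasurable) hw.memLp.1 hv.memLp.1 hφw hψv
  · have e : ∀ n, gradient (fun x => φ n x - ψ n x)
        = fun x => gradient (φ n) x - gradient (ψ n) x := fun n => by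
      ext1 x
      exact gradient_sub ((hφ n).smooth.differentiable (by simp) x)
        ((hψ n).smooth.differentiable (by simp) x)
    simp only [e]
    exact tendsto_eLpNorm_sub_sub (fun n => (hφ n).continuous_gradient.aestronglyMeasurable)
      (fun n => (hψ n).continuous_gradient.aestronglyMeasurable) hw.memLp_grad.1 hv.memLp_grad.1
      hφg hψh

/-- The inclusion of `H^{1,1}_{0,per}(Q)` into `H^{1,1/2}_{0,per}(Q)`. -/
def H11ZeroPer.toHHalf (hΩo : IsOpen Ω) (hΩ : Bornology.IsBounded Ω) (hT : 0 < T)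
    (η : H11ZeroPer Ω T) : HHalfZeroPer Ω T where
  toH10Zero := η.toH10Zero
  summable_half := summable_half_of_H11ZeroPer hΩo hΩ hT η

/-- The difference of two elements of `H^{1,0}_0(Q)`. -/
def H10Zero.sub (y v : H10Zero Ω T) : H10Zero Ω T where
  toFun := fun z => y.toFun z - v.toFun z
  grad := fun z => y.grad z - v.grad z
  memLp := y.memLp.sub v.memLp
  memLp_grad := y.memLp_grad.sub v.memLp_grad
  slice := by
    filter_upwards [y.slice, v.slice] with t h1 h2 using h1.sub h2

/-- The difference of two elements of `H^{1,1/2}_{0,per}(Q)`. -/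
def HHalfZeroPer.sub (hT : 0 < T) (y v : HHalfZeroPer Ω T) :
    HHalfZeroPer Ω T where
  toH10Zero := y.toH10Zero.sub v.toH10Zero
  summable_half := by
    have hω := freq_pos hT
    refine Summable.of_nonneg_of_le (fun k => ?_) (fun k => ?_)
      ((y.summable_half.add v.summable_half).mul_left 2)
    · exact mul_nonneg (mul_nonneg k.cast_nonneg hω.le)
        (integral_nonneg fun x => add_nonneg (sq_nonneg _) (sq_nonneg _))
    · rw [← mul_add, ← integral_add (integrable_sq_coef hT y.memLp k)
        (integrable_sq_coef hT v.memLp k), mul_left_comm, ← integral_const_mul 2]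
      refine mul_le_mul_of_nonneg_left ?_ (mul_nonneg k.cast_nonneg hω.le)
      refine integral_mono_ae (integrable_sq_coef hT (y.toH10Zero.sub v.toH10Zero).memLp k)
        (((integrable_sq_coef hT y.memLp k).add (integrable_sq_coef hT v.memLp k)).const_mul 2) ?_
      filter_upwards [ae_coef_sub y.memLp v.memLp] with x hx
      simp only [H10Zero.sub, (hx k).1, (hx k).2]
      nlinarith [sq_nonneg (coefCos T y.toFun k x + coefCos T v.toFun k x),
        sq_nonneg (coefSin T y.toFun k x + coefSin T v.toFun k x)]

end

/-! ### `L²` pairings, Cauchy-Schwarz and bounded coefficients -/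

section
variable {α E : Type*} [MeasurableSpace α] {μ : Measure α} [NormedAddCommGroup E]
  [InnerProductSpace ℝ E] {f g : α → E}

theorem inner_toLp_eq_integral (hf : MemLp f 2 μ) (hg : MemLp g 2 μ) :
    inner ℝ hf.toLp hg.toLp = ∫ x, inner ℝ (f x) (g x) ∂μ := by
  rw [L2.inner_def]
  refine integral_congr_ae ?_
  filter_upwards [hf.coeFn_toLp, hg.coeFn_toLp] with x h1 h2
  rw [h1, h2]

theorem abs_integral_inner_le (hf : MemLp f 2 μ) (hg : MemLp g 2 μ) :
    |∫ x, inner ℝ (f x) (g x) ∂μ| ≤ (eLpNorm f 2 μ).toReal * (eLpNorm g 2 μ).toReal := by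
  rw [← inner_toLp_eq_integral hf hg, ← Lp.norm_toLp f hf, ← Lp.norm_toLp g hg]
  exact abs_real_inner_le_norm _ _

theorem integrable_inner (hf : MemLp f 2 μ) (hg : MemLp g 2 μ) :
    Integrable (fun x => inner ℝ (f x) (g x)) μ := by
  refine (L2.integrable_inner (𝕜 := ℝ) hf.toLp hg.toLp).congr ?_
  filter_upwards [hf.coeFn_toLp, hg.coeFn_toLp] with x h1 h2
  rw [h1, h2]

theorem sq_toReal_eLpNorm_two (hf : MemLp f 2 μ) :
    (eLpNorm f 2 μ).toReal ^ 2 = ∫ x, ‖f x‖ ^ 2 ∂μ := by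
  rw [← Lp.norm_toLp f hf, ← real_inner_self_eq_norm_sq, inner_toLp_eq_integral]
  simp only [real_inner_self_eq_norm_sq]

theorem tendsto_integral_inner_of_eLpNorm_sub {a : ℕ → α → E} (hf : MemLp f 2 μ)
    (hg : MemLp g 2 μ) (ha : ∀ n, MemLp (a n) 2 μ)
    (h : Tendsto (fun n => eLpNorm (fun x => a n x - g x) 2 μ) atTop (𝓝 0)) :
    Tendsto (fun n => ∫ x, inner ℝ (f x) (a n x) ∂μ) atTop (𝓝 (∫ x, inner ℝ (f x) (g x) ∂μ)) := by
  rw [tendsto_iff_norm_sub_tendsto_zero]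
  have h' := ((ENNReal.tendsto_toReal ENNReal.zero_ne_top).comp h).const_mul (eLpNorm f 2 μ).toReal
  rw [ENNReal.toReal_zero, mul_zero] at h'
  refine squeeze_zero (fun _ => norm_nonneg _) (fun n => ?_) h'
  rw [← integral_sub (integrable_inner hf (ha n)) (integrable_inner hf hg), Real.norm_eq_abs]
  simp only [← inner_sub_right]
  exact abs_integral_inner_le hf ((ha n).sub hg)

end

theorem abs_integral_mul_le {α : Type*} [MeasurableSpace α] {μ : Measure α} {f g : α → ℝ}
    (hf : MemLp f 2 μ) (hg : MemLp g 2 μ) :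
    |∫ x, f x * g x ∂μ| ≤ (eLpNorm f 2 μ).toReal * (eLpNorm g 2 μ).toReal := by
  have := abs_integral_inner_le hg hf
  simpa [mul_comm (eLpNorm g 2 μ).toReal] using this

theorem memLp_two_smul_of_bounded {α E : Type*} [MeasurableSpace α] {μ : Measure α}
    [NormedAddCommGroup E] [NormedSpace ℝ E] {c : α → ℝ} {f : α → E} {C : ℝ}
    (hc : AEStronglyMeasurable c μ) (hC : ∀ᵐ x ∂μ, |c x| ≤ C) (hf : MemLp f 2 μ) :
    MemLp (fun x => c x • f x) 2 μ := by
  refine hf.of_le_mul (c := C) (hc.smul hf.1) ?_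
  filter_upwards [hC] with x hx
  rw [norm_smul]
  exact mul_le_mul_of_nonneg_right hx (norm_nonneg _)

/-! ### Integration by parts in space and Friedrichs' inequality on `Q` -/

section
variable {d : ℕ} {Ω : Set (Sp d)} {T : ℝ}

theorem IsTest.memLp_gradient {μ : Measure (Sp d)} [IsFiniteMeasure μ] {φ : Sp d → ℝ}
    (hφ : IsTest Ω φ) : MemLp (gradient φ) 2 μ := by
  obtain ⟨C, hC⟩ := (hφ.smooth.continuous_fderiv (by simp)).bounded_above_of_compact_support
    (hφ.compact_support.fderiv ℝ)
  refine MemLp.of_bound hφ.continuous_gradient.aestronglyMeasurable C (ae_of_all _ fun x => ?_)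
  rw [gradient, LinearIsometryEquiv.norm_map]
  exact hC x

/-- A weak divergence can be tested with functions in `H^1_0(Ω)`. -/
theorem IsH1Zero.integral_div_mul (hΩ : Bornology.IsBounded Ω) {w D : Sp d → ℝ}
    {g τ : Sp d → Sp d} (hw : IsH1Zero Ω w g) (hD : MemLp D 2 (muOmega Ω))
    (hτ : MemLp τ 2 (muOmega Ω))
    (hdiv : ∀ φ : Sp d → ℝ, IsTest Ω φ → ∫ x, D x * φ x ∂(muOmega Ω)
      = - ∫ x, inner ℝ (τ x) (gradient φ x) ∂(muOmega Ω)) :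
    ∫ x, D x * w x ∂(muOmega Ω) = - ∫ x, inner ℝ (τ x) (g x) ∂(muOmega Ω) := by
  have := isFiniteMeasure_muOmega hΩ
  obtain ⟨φ, hφ, hφw, hφg⟩ := hw.approx
  have h1 := tendsto_integral_inner_of_eLpNorm_sub hD hw.memLp (fun n => (hφ n).memLp 2) hφw
  have h2 := (tendsto_integral_inner_of_eLpNorm_sub hτ hw.memLp_grad
    (fun n => (hφ n).memLp_gradient) hφg).neg
  have hm : ∀ a b : ℝ, inner ℝ a b = a * b := fun a b => by simp [mul_comm]
  simp only [hm] at h1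
  refine tendsto_nhds_unique (h1.congr fun n => ?_) h2
  exact hdiv _ (hφ n)

/-- Integration by parts in space on `Q`. -/
theorem integral_div_mul (hΩ : Bornology.IsBounded Ω) (τ : HDiv Ω T)
    (hdiv : MemLp τ.div 2 (muQ Ω T)) (e : H10Zero Ω T) :
    ∫ z, τ.div z * e.toFun z ∂(muQ Ω T) = - ∫ z, inner ℝ (τ.toFun z) (e.grad z) ∂(muQ Ω T) := by
  have i1 : Integrable (fun z => τ.div z * e.toFun z) (muQ Ω T) := hdiv.integrable_mul e.memLp
  have i2 := integrable_inner τ.memLp e.memLp_grad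
  have s1 := ae_memLp_space τ.memLp
  rw [muQ_eq_prod] at i1 i2 ⊢
  rw [integral_prod_symm _ i1, integral_prod_symm _ i2, ← integral_neg]
  refine integral_congr_ae ?_
  filter_upwards [s1, τ.memLp_div, τ.isDiv, e.slice] with t h1 h2 h3 h4
  exact h4.integral_div_mul hΩ h2 h1 h3

/-- Friedrichs' inequality on `Q`. -/
theorem friedrichs_muQ {CF : ℝ} (hCF : IsFriedrichsConstant Ω CF) (e : H10Zero Ω T) :
    (eLpNorm e.toFun 2 (muQ Ω T)).toReal ≤ CF * (eLpNorm e.grad 2 (muQ Ω T)).toReal := by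
  refine le_of_sq_le_sq ?_ (mul_nonneg hCF.1.le ENNReal.toReal_nonneg)
  rw [mul_pow, sq_toReal_eLpNorm_two e.memLp, sq_toReal_eLpNorm_two e.memLp_grad]
  have i1 := e.memLp.integrable_norm_pow two_ne_zero
  have i2 := e.memLp_grad.integrable_norm_pow two_ne_zero
  rw [muQ_eq_prod] at i1 i2 ⊢
  rw [integral_prod_symm _ i1, integral_prod_symm _ i2, ← integral_const_mul]
  refine integral_mono_ae i1.integral_prod_right (i2.integral_prod_right.const_mul _) ?_
  filter_upwards [e.slice] with t ht
  have h := ENNReal.toReal_mono (ENNReal.mul_ne_top ENNReal.ofReal_ne_top ht.memLp_grad.2.ne)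
    (hCF.2 _ _ ht)
  rw [ENNReal.toReal_mul, ENNReal.toReal_ofReal hCF.1.le] at h
  have h2 := pow_le_pow_left₀ ENNReal.toReal_nonneg h 2
  rwa [mul_pow, sq_toReal_eLpNorm_two ht.memLp, sq_toReal_eLpNorm_two ht.memLp_grad] at h2

end

/-! ### Cost expansion, energy estimate and the lower bound -/

section
variable {d : ℕ} {Ω : Set (Sp d)} {T : ℝ}

theorem aestronglyMeasurable_comp_fst {c : Sp d → ℝ}
    (hc : AEStronglyMeasurable c (muOmega Ω)) :
    AEStronglyMeasurable (fun z : Sp d × ℝ => c z.1) (muQ Ω T) := by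
  rw [muQ_eq_prod]; exact hc.comp_fst

theorem ae_muQ_of_forall_mem (hΩo : IsOpen Ω) {p : Sp d → Prop} (hp : ∀ x ∈ Ω, p x) :
    ∀ᵐ z ∂(muQ Ω T), p z.1 := by
  rw [muQ_eq_prod]
  exact Measure.quasiMeasurePreserving_fst.ae
    ((ae_restrict_iff' hΩo.measurableSet).2 (ae_of_all _ hp))

theorem memLp_mul_of_bounds (hΩo : IsOpen Ω) {c : Sp d → ℝ} {cl cu : ℝ}
    (hcm : AEStronglyMeasurable c (muOmega Ω)) (hc : ∀ x ∈ Ω, cl ≤ c x ∧ c x ≤ cu)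
    {E : Type*} [NormedAddCommGroup E] [NormedSpace ℝ E] {f : Sp d × ℝ → E}
    (hf : MemLp f 2 (muQ Ω T)) : MemLp (fun z => c z.1 • f z) 2 (muQ Ω T) :=
  memLp_two_smul_of_bounded (aestronglyMeasurable_comp_fst hcm)
    (ae_muQ_of_forall_mem hΩo fun x hx => abs_le_max_abs_abs (hc x hx).1 (hc x hx).2) hf

/-- The cost of an admissible pair, expanded around `(η, -λ⁻¹ ζ)`. -/
theorem cost_expansion (hΩo : IsOpen Ω) (hΩ : Bornology.IsBounded Ω) (hT : 0 < T)
    {σ ν : Sp d → ℝ} (hσm : AEStronglyMeasurable σ (muOmega Ω))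
    (hνm : AEStronglyMeasurable ν (muOmega Ω)) {σlow σup νlow νup : ℝ}
    (hσ : ∀ x ∈ Ω, σlow ≤ σ x ∧ σ x ≤ σup) (hν : ∀ x ∈ Ω, νlow ≤ ν x ∧ ν x ≤ νup)
    {lam : ℝ} (hlam : 0 < lam) {yd : Sp d × ℝ → ℝ} (hyd : MemLp yd 2 (muQ Ω T))
    (η ζ : H11ZeroPer Ω T) (ρ : HDiv Ω T) (hρ : MemLp ρ.div 2 (muQ Ω T))
    (y : HHalfZeroPer Ω T) {u : Sp d × ℝ → ℝ} (hyu : IsAdmissible Ω T σ ν y u) :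
    cost Ω T lam yd y.toFun u
      = (1 / 2 * (normQ Ω T (fun z => η.toFun z - yd z)).toReal ^ 2
          + 1 / (2 * lam) * (normQ Ω T ζ.toFun).toReal ^ 2
          - ∫ z, (ν z.1 * inner ℝ (η.grad z) (ζ.grad z) + σ z.1 * η.dt z * ζ.toFun z
              + lam⁻¹ * ζ.toFun z ^ 2) ∂(muQ Ω T))
        + lam / 2 * (normQ Ω T (fun z => u z + lam⁻¹ * ζ.toFun z)).toReal ^ 2
        + 1 / 2 * (normQ Ω T (fun z => y.toFun z - η.toFun z)).toReal ^ 2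
        + ∫ z, R3 σ yd ζ ρ η z * (y.toFun z - η.toFun z) ∂(muQ Ω T)
        + ∫ z, inner ℝ (R4 ν ζ ρ z) (y.grad z - η.grad z) ∂(muQ Ω T) := by
  obtain ⟨hu, hst⟩ := hyu
  have hσb : ∀ᵐ x ∂(muOmega Ω), |σ x| ≤ max |σlow| |σup| :=
    (ae_restrict_iff' hΩo.measurableSet).2
      (ae_of_all _ fun x hx => abs_le_max_abs_abs (hσ x hx).1 (hσ x hx).2)
  have Lη := η.memLp
  have Lζ := ζ.memLp
  have Ly := y.memLp
  have Le : MemLp (fun z => y.toFun z - η.toFun z) 2 (muQ Ω T) := Ly.sub Lη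
  have Lge : MemLp (fun z => y.grad z - η.grad z) 2 (muQ Ω T) := y.memLp_grad.sub η.memLp_grad
  have Lw : MemLp (fun z => u z + lam⁻¹ * ζ.toFun z) 2 (muQ Ω T) := hu.add (Lζ.const_mul _)
  have Lyd : MemLp (fun z => y.toFun z - yd z) 2 (muQ Ω T) := Ly.sub hyd
  have Lηd : MemLp (fun z => η.toFun z - yd z) 2 (muQ Ω T) := Lη.sub hyd
  have Lσζ : MemLp (fun z => σ z.1 * ζ.dt z) 2 (muQ Ω T) :=
    memLp_mul_of_bounds hΩo hσm hσ ζ.memLp_dt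
  have Lση : MemLp (fun z => σ z.1 * η.dt z) 2 (muQ Ω T) :=
    memLp_mul_of_bounds hΩo hσm hσ η.memLp_dt
  have Lνζ : MemLp (fun z => ν z.1 • ζ.grad z) 2 (muQ Ω T) :=
    memLp_mul_of_bounds hΩo hνm hν ζ.memLp_grad
  have LR3 : MemLp (R3 σ yd ζ ρ η) 2 (muQ Ω T) := (Lηd.add hρ).add Lσζ
  have LR4 : MemLp (R4 ν ζ ρ) 2 (muQ Ω T) := ρ.memLp.sub Lνζ
  have hz1 := hst (ζ.toHHalf hΩo hΩ hT)
  change ∫ z, ν z.1 * inner ℝ (y.grad z) (ζ.grad z) ∂(muQ Ω T)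
    + halfForm Ω T σ y.toFun ζ.toFun = ∫ z, u z * ζ.toFun z ∂(muQ Ω T) at hz1
  rw [halfForm_swap, halfForm_eq_integral hΩo hΩ hT hσm hσb ζ Ly] at hz1
  have hz2 := halfForm_swap Ω T σ η.toFun ζ.toFun
  rw [halfForm_eq_integral hΩo hΩ hT hσm hσb ζ Lη,
    halfForm_eq_integral hΩo hΩ hT hσm hσb η Lζ] at hz2
  have hz3 := integral_div_mul hΩ ρ hρ (y.toH10Zero.sub η.toH10Zero)
  simp only [H10Zero.sub] at hz3
  have iνyζ : Integrable (fun z => ν z.1 * inner ℝ (y.grad z) (ζ.grad z)) (muQ Ω T) := by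
    simpa only [inner_smul_right] using integrable_inner y.memLp_grad Lνζ
  have iνηζ : Integrable (fun z => ν z.1 * inner ℝ (η.grad z) (ζ.grad z)) (muQ Ω T) := by
    simpa only [inner_smul_right] using integrable_inner η.memLp_grad Lνζ
  have iuζ : Integrable (fun z => u z * ζ.toFun z) (muQ Ω T) := hu.integrable_mul Lζ
  have iσζy : Integrable (fun z => σ z.1 * ζ.dt z * y.toFun z) (muQ Ω T) := Lσζ.integrable_mul Ly
  have iσζη : Integrable (fun z => σ z.1 * ζ.dt z * η.toFun z) (muQ Ω T) := Lσζ.integrable_mul Lη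
  have iσηζ : Integrable (fun z => σ z.1 * η.dt z * ζ.toFun z) (muQ Ω T) := Lση.integrable_mul Lζ
  have iρe : Integrable (fun z => ρ.div z * (y.toFun z - η.toFun z)) (muQ Ω T) :=
    hρ.integrable_mul Le
  have iρg := integrable_inner ρ.memLp Lge
  have iR3 : Integrable (fun z => R3 σ yd ζ ρ η z * (y.toFun z - η.toFun z)) (muQ Ω T) :=
    LR3.integrable_mul Le
  have iR4 := integrable_inner LR4 Lge
  have iζ2 : Integrable (fun z => lam⁻¹ * ζ.toFun z ^ 2) (muQ Ω T) := Lζ.integrable_sq.const_mul _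
  have sq : ∀ {f : Sp d × ℝ → ℝ}, MemLp f 2 (muQ Ω T) →
      (normQ Ω T f).toReal ^ 2 = ∫ z, f z ^ 2 ∂(muQ Ω T) := fun hf => by
    simpa [normQ] using sq_toReal_eLpNorm_two hf
  -- Pure algebra: the defect of the claimed identity equals a sum whose integral is zero, by the
  -- state equation tested with `ζ` (`hz1`), antisymmetry for `η, ζ` (`hz2`) and integration by
  -- parts for `ρ` (`hz3`).
  have hpt : ∀ z, 1 / 2 * (y.toFun z - yd z) ^ 2 + lam / 2 * u z ^ 2
      - 1 / 2 * (η.toFun z - yd z) ^ 2 - 1 / (2 * lam) * ζ.toFun z ^ 2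
      + (ν z.1 * inner ℝ (η.grad z) (ζ.grad z) + σ z.1 * η.dt z * ζ.toFun z
          + lam⁻¹ * ζ.toFun z ^ 2)
      - lam / 2 * (u z + lam⁻¹ * ζ.toFun z) ^ 2 - 1 / 2 * (y.toFun z - η.toFun z) ^ 2
      - R3 σ yd ζ ρ η z * (y.toFun z - η.toFun z)
      - inner ℝ (R4 ν ζ ρ z) (y.grad z - η.grad z)
      = ν z.1 * inner ℝ (y.grad z) (ζ.grad z) - σ z.1 * ζ.dt z * y.toFun z - u z * ζ.toFun z
        + σ z.1 * η.dt z * ζ.toFun z + σ z.1 * ζ.dt z * η.toFun z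
        - ρ.div z * (y.toFun z - η.toFun z) - inner ℝ (ρ.toFun z) (y.grad z - η.grad z) := by
    intro z
    have hi : inner ℝ (R4 ν ζ ρ z) (y.grad z - η.grad z)
        = inner ℝ (ρ.toFun z) (y.grad z - η.grad z)
          - (ν z.1 * inner ℝ (y.grad z) (ζ.grad z) - ν z.1 * inner ℝ (η.grad z) (ζ.grad z)) := by
      rw [R4, inner_sub_left, inner_smul_left, inner_sub_right (ζ.grad z),
        real_inner_comm (y.grad z), real_inner_comm (η.grad z)]
      simp only [conj_trivial]
      ring
    rw [hi]
    simp only [R3]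
    field_simp
    ring
  have hint := integral_congr_ae (μ := muQ Ω T) (ae_of_all _ hpt)
  have j1 := Lyd.integrable_sq.const_mul (1 / 2)
  have j2 := hu.integrable_sq.const_mul (lam / 2)
  have j3 := Lηd.integrable_sq.const_mul (1 / 2)
  have j4 := Lζ.integrable_sq.const_mul (1 / (2 * lam))
  have j5 := (iνηζ.fun_add iσηζ).fun_add iζ2
  have j6 := Lw.integrable_sq.const_mul (lam / 2)
  have j7 := Le.integrable_sq.const_mul (1 / 2)
  rw [integral_sub
      (((((((j1.fun_add j2).sub' j3).sub' j4).fun_add j5).sub' j6).sub' j7).sub' iR3) iR4,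
    integral_sub ((((((j1.fun_add j2).sub' j3).sub' j4).fun_add j5).sub' j6).sub' j7) iR3,
    integral_sub (((((j1.fun_add j2).sub' j3).sub' j4).fun_add j5).sub' j6) j7,
    integral_sub ((((j1.fun_add j2).sub' j3).sub' j4).fun_add j5) j6,
    integral_add (((j1.fun_add j2).sub' j3).sub' j4) j5,
    integral_sub ((j1.fun_add j2).sub' j3) j4, integral_sub (j1.fun_add j2) j3, integral_add j1 j2,
    integral_sub (((((iνyζ.sub' iσζy).sub' iuζ).fun_add iσηζ).fun_add iσζη).sub' iρe) iρg,
    integral_sub ((((iνyζ.sub' iσζy).sub' iuζ).fun_add iσηζ).fun_add iσζη) iρe,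
    integral_add (((iνyζ.sub' iσζy).sub' iuζ).fun_add iσηζ) iσζη,
    integral_add ((iνyζ.sub' iσζy).sub' iuζ) iσηζ,
    integral_sub (iνyζ.sub' iσζy) iuζ, integral_sub iνyζ iσζy] at hint
  simp only [integral_const_mul] at hint
  rw [cost, sq Lyd, sq hu, sq Lηd, sq Lζ, sq Lw, sq Le]
  linarith

/-- Energy estimate for the gradient of the deviation of a state from `η`. -/
theorem gradient_deviation_le (hΩo : IsOpen Ω) (hΩ : Bornology.IsBounded Ω) (hT : 0 < T)
    {σ ν : Sp d → ℝ} (hσm : AEStronglyMeasurable σ (muOmega Ω))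
    (hνm : AEStronglyMeasurable ν (muOmega Ω)) {σlow σup νlow νup : ℝ}
    (hσ : ∀ x ∈ Ω, σlow ≤ σ x ∧ σ x ≤ σup) (hν : ∀ x ∈ Ω, νlow ≤ ν x ∧ ν x ≤ νup)
    {CF : ℝ} (hCF : IsFriedrichsConstant Ω CF)
    {v : Sp d × ℝ → ℝ} (hv : MemLp v 2 (muQ Ω T))
    (η : H11ZeroPer Ω T) (τ : HDiv Ω T) (hτ : MemLp τ.div 2 (muQ Ω T))
    (y : HHalfZeroPer Ω T) {u : Sp d × ℝ → ℝ} (hyu : IsAdmissible Ω T σ ν y u) :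
    νlow * (normQ Ω T (fun z => y.grad z - η.grad z)).toReal
      ≤ CF * (normQ Ω T (fun z => u z - v z)).toReal
        + (CF * (normQ Ω T (R1 σ η τ v)).toReal + (normQ Ω T (R2 ν η τ)).toReal) := by
  obtain ⟨hu, hst⟩ := hyu
  have hσb : ∀ᵐ x ∂(muOmega Ω), |σ x| ≤ max |σlow| |σup| :=
    (ae_restrict_iff' hΩo.measurableSet).2
      (ae_of_all _ fun x hx => abs_le_max_abs_abs (hσ x hx).1 (hσ x hx).2)
  set e : H10Zero Ω T := y.toH10Zero.sub η.toH10Zero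
  have hef : (fun z => y.toFun z - η.toFun z) = e.toFun := rfl
  have heg : (fun z => y.grad z - η.grad z) = e.grad := rfl
  have Lw : MemLp (fun z => u z - v z) 2 (muQ Ω T) := hu.sub hv
  have Lση : MemLp (fun z => σ z.1 * η.dt z) 2 (muQ Ω T) :=
    memLp_mul_of_bounds hΩo hσm hσ η.memLp_dt
  have Lνη : MemLp (fun z => ν z.1 • η.grad z) 2 (muQ Ω T) :=
    memLp_mul_of_bounds hΩo hνm hν η.memLp_grad
  have Lνe : MemLp (fun z => ν z.1 • e.grad z) 2 (muQ Ω T) :=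
    memLp_mul_of_bounds hΩo hνm hν e.memLp_grad
  have Lνy : MemLp (fun z => ν z.1 • y.grad z) 2 (muQ Ω T) :=
    memLp_mul_of_bounds hΩo hνm hν y.memLp_grad
  have LR1 : MemLp (R1 σ η τ v) 2 (muQ Ω T) := (Lση.sub hτ).sub hv
  have LR2 : MemLp (R2 ν η τ) 2 (muQ Ω T) := τ.memLp.sub Lνη
  have hz1 := hst (y.sub hT (η.toHHalf hΩo hΩ hT))
  change ∫ z, ν z.1 * inner ℝ (y.grad z) (e.grad z) ∂(muQ Ω T)
    + halfForm Ω T σ y.toFun (fun z => y.toFun z - η.toFun z)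
      = ∫ z, u z * e.toFun z ∂(muQ Ω T) at hz1
  -- Since the form vanishes on `(e, e)`, `y` may be replaced by `η` in the time term, which then
  -- becomes an integral of `σ ∂_t η`.
  rw [halfForm_sub_self y.memLp η.memLp, hef,
    halfForm_eq_integral hΩo hΩ hT hσm hσb η e.memLp] at hz1
  have hz2 := integral_div_mul hΩ τ hτ e
  have iνye : Integrable (fun z => ν z.1 * inner ℝ (y.grad z) (e.grad z)) (muQ Ω T) := by
    simpa only [inner_smul_left, conj_trivial] using integrable_inner Lνy e.memLp_grad
  have iνee : Integrable (fun z => ν z.1 * ‖e.grad z‖ ^ 2) (muQ Ω T) := by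
    simpa only [inner_smul_left, conj_trivial, real_inner_self_eq_norm_sq] using
      integrable_inner Lνe e.memLp_grad
  have iue : Integrable (fun z => u z * e.toFun z) (muQ Ω T) := hu.integrable_mul e.memLp
  have iσηe : Integrable (fun z => σ z.1 * η.dt z * e.toFun z) (muQ Ω T) :=
    Lση.integrable_mul e.memLp
  have iτe : Integrable (fun z => τ.div z * e.toFun z) (muQ Ω T) := hτ.integrable_mul e.memLp
  have iτg := integrable_inner τ.memLp e.memLp_grad
  have iwe : Integrable (fun z => (u z - v z) * e.toFun z) (muQ Ω T) := Lw.integrable_mul e.memLp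
  have iR1 : Integrable (fun z => R1 σ η τ v z * e.toFun z) (muQ Ω T) :=
    LR1.integrable_mul e.memLp
  have iR2 := integrable_inner LR2 e.memLp_grad
  have hpt : ∀ z, ν z.1 * ‖e.grad z‖ ^ 2 - (u z - v z) * e.toFun z + R1 σ η τ v z * e.toFun z
      - inner ℝ (R2 ν η τ z) (e.grad z)
      = ν z.1 * inner ℝ (y.grad z) (e.grad z) + σ z.1 * η.dt z * e.toFun z - u z * e.toFun z
        - τ.div z * e.toFun z - inner ℝ (τ.toFun z) (e.grad z) := by
    intro z
    have h1 : inner ℝ (R2 ν η τ z) (e.grad z)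
        = inner ℝ (τ.toFun z) (e.grad z) - ν z.1 * inner ℝ (η.grad z) (e.grad z) := by
      rw [R2, inner_sub_left, inner_smul_left]; rfl
    have h2 : ‖e.grad z‖ ^ 2 = inner ℝ (y.grad z) (e.grad z) - inner ℝ (η.grad z) (e.grad z) := by
      rw [← inner_sub_left, ← real_inner_self_eq_norm_sq]; rfl
    rw [h1, h2]
    simp only [R1]
    ring
  have hint := integral_congr_ae (μ := muQ Ω T) (ae_of_all _ hpt)
  rw [integral_sub ((iνee.sub' iwe).fun_add iR1) iR2, integral_add (iνee.sub' iwe) iR1,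
    integral_sub iνee iwe, integral_sub (((iνye.fun_add iσηe).sub' iue).sub' iτe) iτg,
    integral_sub ((iνye.fun_add iσηe).sub' iue) iτe, integral_sub (iνye.fun_add iσηe) iue,
    integral_add iνye iσηe] at hint
  have b1 := (abs_le.1 (abs_integral_mul_le Lw e.memLp)).2
  have b2 := (abs_le.1 (abs_integral_mul_le LR1 e.memLp)).1
  have b3 := (abs_le.1 (abs_integral_inner_le LR2 e.memLp_grad)).2
  have hfr := friedrichs_muQ hCF e
  have hlow : νlow * (eLpNorm e.grad 2 (muQ Ω T)).toReal ^ 2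
      ≤ ∫ z, ν z.1 * ‖e.grad z‖ ^ 2 ∂(muQ Ω T) := by
    rw [sq_toReal_eLpNorm_two e.memLp_grad, ← integral_const_mul]
    refine integral_mono_ae ((e.memLp_grad.integrable_norm_pow two_ne_zero).const_mul _) iνee ?_
    filter_upwards [ae_muQ_of_forall_mem hΩo hν] with z hz
    exact mul_le_mul_of_nonneg_right hz.1 (sq_nonneg _)
  rw [heg]
  unfold normQ
  set G := (eLpNorm e.grad 2 (muQ Ω T)).toReal
  set W := (eLpNorm (fun z => u z - v z) 2 (muQ Ω T)).toReal
  set r1 := (eLpNorm (R1 σ η τ v) 2 (muQ Ω T)).toReal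
  set r2 := (eLpNorm (R2 ν η τ) 2 (muQ Ω T)).toReal
  set n := (eLpNorm e.toFun 2 (muQ Ω T)).toReal
  have hG : 0 ≤ G := ENNReal.toReal_nonneg
  have hW : 0 ≤ W := ENNReal.toReal_nonneg
  have hr1 : 0 ≤ r1 := ENNReal.toReal_nonneg
  have hr2 : 0 ≤ r2 := ENNReal.toReal_nonneg
  have hC := hCF.1
  -- The energy inequality is quadratic in `G`; it is divided by `G`, so `G = 0` is separate.
  rcases hG.eq_or_lt with h0 | h0
  · rw [← h0, mul_zero]; positivity
  · refine le_of_mul_le_mul_right ?_ h0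
    have m1 := mul_le_mul_of_nonneg_left hfr hW
    have m2 := mul_le_mul_of_nonneg_left hfr hr1
    nlinarith

theorem mu1_pos {νlow σlow : ℝ} (hν : 0 < νlow) (hσ : 0 < σlow) : 0 < mu1 νlow σlow := by
  have := lt_min hν hσ
  unfold mu1; positivity

theorem mu1_le {νlow σlow : ℝ} (hν : 0 < νlow) (hσ : 0 < σlow) : mu1 νlow σlow ≤ νlow := by
  have h := lt_min hν hσ
  unfold mu1
  exact (div_le_self h.le (Real.one_le_sqrt.2 one_le_two)).trans (min_le_left _ _)

/-- Completing the square in `W` around `C A / (m λ)` costs only `C² A² / (2 m² λ)`, half of what is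
subtracted; the other half is slack. -/
theorem young_bound {main J lam W m C A B G : ℝ} (hlam : 0 < lam) (hm : 0 < m) (hA : 0 ≤ A)
    (hJ : main + lam / 2 * W ^ 2 - A * G ≤ J) (hG : m * G ≤ C * W + B) :
    main - C ^ 2 / (m ^ 2 * lam) * A ^ 2 - 1 / m * B * A ≤ J := by
  have h1 : A * G ≤ A * ((C * W + B) / m) := by
    gcongr
    rw [le_div_iff₀ hm]; linarith
  have h2 : lam / 2 * W ^ 2 - A * ((C * W + B) / m) + C ^ 2 / (m ^ 2 * lam) * A ^ 2
      + 1 / m * B * A = lam / 2 * (W - C * A / (m * lam)) ^ 2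
        + C ^ 2 * A ^ 2 / (2 * m ^ 2 * lam) := by
    field_simp
    ring
  have h3 : 0 ≤ lam / 2 * (W - C * A / (m * lam)) ^ 2 + C ^ 2 * A ^ 2 / (2 * m ^ 2 * lam) := by
    positivity
  linarith

/-- Only admissibility is used, so the bound passes to the infimum. The case distinctions below
treat divergences outside `L²(Q)`. -/
theorem minorant_le_cost (hΩo : IsOpen Ω) (hΩ : Bornology.IsBounded Ω) (hT : 0 < T)
    {σ ν : Sp d → ℝ} (hσm : AEStronglyMeasurable σ (muOmega Ω))
    (hνm : AEStronglyMeasurable ν (muOmega Ω)) {σlow σup νlow νup : ℝ}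
    (hσlow : 0 < σlow) (hνlow : 0 < νlow)
    (hσ : ∀ x ∈ Ω, σlow ≤ σ x ∧ σ x ≤ σup) (hν : ∀ x ∈ Ω, νlow ≤ ν x ∧ ν x ≤ νup)
    {lam : ℝ} (hlam : 0 < lam) {yd : Sp d × ℝ → ℝ} (hyd : MemLp yd 2 (muQ Ω T))
    {CF : ℝ} (hCF : IsFriedrichsConstant Ω CF)
    (η ζ : H11ZeroPer Ω T) (τ ρ : HDiv Ω T)
    (y : HHalfZeroPer Ω T) {u : Sp d × ℝ → ℝ} (hyu : IsAdmissible Ω T σ ν y u) :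
    minorant σ ν σlow νlow lam CF yd η ζ τ ρ ≤ (cost Ω T lam yd y.toFun u : EReal) := by
  have hm := mu1_pos hνlow hσlow
  have hC := hCF.1
  have Lσζ : MemLp (fun z => σ z.1 * ζ.dt z) 2 (muQ Ω T) :=
    memLp_mul_of_bounds hΩo hσm hσ ζ.memLp_dt
  have Lση : MemLp (fun z => σ z.1 * η.dt z) 2 (muQ Ω T) :=
    memLp_mul_of_bounds hΩo hσm hσ η.memLp_dt
  have Lν : ∀ {v : H11ZeroPer Ω T}, MemLp (fun z => ν z.1 • v.grad z) 2 (muQ Ω T) := fun {v} =>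
    memLp_mul_of_bounds hΩo hνm hν v.memLp_grad
  have Lηd : MemLp (fun z => η.toFun z - yd z) 2 (muQ Ω T) := η.memLp.sub hyd
  have Lv : MemLp (fun z => -lam⁻¹ * ζ.toFun z) 2 (muQ Ω T) := ζ.memLp.const_mul _
  have LR4 : MemLp (R4 ν ζ ρ) 2 (muQ Ω T) := ρ.memLp.sub Lν
  have LR2 : MemLp (R2 ν η τ) 2 (muQ Ω T) := τ.memLp.sub Lν
  have mR3 : AEStronglyMeasurable (R3 σ yd ζ ρ η) (muQ Ω T) :=
    (Lηd.1.add ρ.aestronglyMeasurable_div).add Lσζ.1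
  have mR1 : AEStronglyMeasurable (R1 σ η τ fun z => -lam⁻¹ * ζ.toFun z) (muQ Ω T) :=
    (Lση.1.sub τ.aestronglyMeasurable_div).sub Lv.1
  have hR4 : normQ Ω T (R4 ν ζ ρ) ≠ ⊤ := LR4.2.ne
  have hR2 : normQ Ω T (R2 ν η τ) ≠ ⊤ := LR2.2.ne
  have hCF0 : ENNReal.ofReal CF ≠ 0 := by simpa using hC
  unfold minorant
  by_cases hR3 : normQ Ω T (R3 σ yd ζ ρ η) = ⊤
  · have hc : ENNReal.ofReal (CF ^ 2 / (mu1 νlow σlow ^ 2 * lam)) ≠ 0 := by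
      rw [ne_eq, ENNReal.ofReal_eq_zero, not_le]; positivity
    rw [hR3, ENNReal.mul_top hCF0, top_add, ENNReal.top_pow two_ne_zero, ENNReal.mul_top hc]
    simp
  have LR3 : MemLp (R3 σ yd ζ ρ η) 2 (muQ Ω T) := ⟨mR3, lt_top_iff_ne_top.2 hR3⟩
  -- All other terms of `R3` are square integrable, so a finite residual norm puts the divergence in
  -- `L²(Q)`.
  have hρ : MemLp ρ.div 2 (muQ Ω T) := by
    convert! (LR3.sub Lηd).sub Lσζ using 1
    ext z
    simp only [R3, Pi.sub_apply]
    ring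
  have hexp := cost_expansion hΩo hΩ hT hσm hνm hσ hν hlam hyd η ζ ρ hρ y hyu
  have Le := (y.toH10Zero.sub η.toH10Zero).memLp
  have Lg := (y.toH10Zero.sub η.toH10Zero).memLp_grad
  have b1 := (abs_le.1 (abs_integral_mul_le LR3 Le)).1
  have b2 := (abs_le.1 (abs_integral_inner_le LR4 Lg)).1
  have hfr := friedrichs_muQ hCF (y.toH10Zero.sub η.toH10Zero)
  simp only [H10Zero.sub] at b1 b2 hfr
  have hres := mul_le_mul_of_nonneg_left hfr
    (ENNReal.toReal_nonneg (a := eLpNorm (R3 σ yd ζ ρ η) 2 (muQ Ω T)))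
  set main : ℝ := 1 / 2 * (normQ Ω T (fun z => η.toFun z - yd z)).toReal ^ 2
      + 1 / (2 * lam) * (normQ Ω T ζ.toFun).toReal ^ 2
      - ∫ z, (ν z.1 * inner ℝ (η.grad z) (ζ.grad z) + σ z.1 * η.dt z * ζ.toFun z
          + lam⁻¹ * ζ.toFun z ^ 2) ∂(muQ Ω T)
  set A : ℝ≥0∞ := ENNReal.ofReal CF * normQ Ω T (R3 σ yd ζ ρ η) + normQ Ω T (R4 ν ζ ρ) with hA
  have hAtop : A ≠ ⊤ := ENNReal.add_ne_top.2 ⟨ENNReal.mul_ne_top ENNReal.ofReal_ne_top hR3, hR4⟩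
  have hAr : A.toReal = CF * (normQ Ω T (R3 σ yd ζ ρ η)).toReal
      + (normQ Ω T (R4 ν ζ ρ)).toReal := by
    rw [hA, ENNReal.toReal_add (ENNReal.mul_ne_top ENNReal.ofReal_ne_top hR3) hR4,
      ENNReal.toReal_mul, ENNReal.toReal_ofReal hC.le]
  have hJ : main + lam / 2 * (normQ Ω T (fun z => u z + lam⁻¹ * ζ.toFun z)).toReal ^ 2
      - A.toReal * (normQ Ω T (fun z => y.grad z - η.grad z)).toReal
      ≤ cost Ω T lam yd y.toFun u := by
    rw [hexp, hAr]
    unfold normQ at *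
    nlinarith [sq_nonneg (eLpNorm (fun z => y.toFun z - η.toFun z) 2 (muQ Ω T)).toReal]
  -- Here the last product is zero even for an infinite `R1`, by `∞ · 0 = 0`; `hJ` then suffices
  -- without the energy estimate. For `A ≠ 0` an infinite `R1` sends the minorant to `-∞`.
  by_cases hA0 : A = 0
  · rw [hA0, ENNReal.toReal_zero, zero_mul, sub_zero] at hJ
    rw [hA0, mul_zero, zero_pow two_ne_zero, mul_zero]
    simp only [EReal.coe_ennreal_zero, sub_zero]
    refine EReal.coe_le_coe_iff.2 (le_trans ?_ hJ)
    exact le_add_of_nonneg_right (by positivity)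
  have hm' : ENNReal.ofReal (1 / mu1 νlow σlow) ≠ 0 := by
    rw [ne_eq, ENNReal.ofReal_eq_zero, not_le]; positivity
  by_cases hR1 : normQ Ω T (R1 σ η τ fun z => -lam⁻¹ * ζ.toFun z) = ⊤
  · rw [hR1, ENNReal.mul_top hCF0, top_add, ENNReal.mul_top hm', ENNReal.top_mul hA0]
    simp
  have LR1 : MemLp (R1 σ η τ fun z => -lam⁻¹ * ζ.toFun z) 2 (muQ Ω T) :=
    ⟨mR1, lt_top_iff_ne_top.2 hR1⟩
  have hτ : MemLp τ.div 2 (muQ Ω T) := by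
    convert! (Lση.sub Lv).sub LR1 using 1
    ext z
    simp only [R1, Pi.sub_apply]
    ring
  have hG := gradient_deviation_le hΩo hΩ hT hσm hνm hσ hν hCF Lv η τ hτ y hyu
  have ew : (fun z => u z - -lam⁻¹ * ζ.toFun z) = fun z => u z + lam⁻¹ * ζ.toFun z := by
    ext z; ring
  rw [ew] at hG
  have hG' := (mul_le_mul_of_nonneg_right (mu1_le hνlow hσlow) ENNReal.toReal_nonneg).trans hG
  have hfin := young_bound hlam hm ENNReal.toReal_nonneg hJ hG'
  set B : ℝ≥0∞ := ENNReal.ofReal CF * normQ Ω T (R1 σ η τ fun z => -lam⁻¹ * ζ.toFun z)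
    + normQ Ω T (R2 ν η τ) with hB
  have hBtop : B ≠ ⊤ := ENNReal.add_ne_top.2 ⟨ENNReal.mul_ne_top ENNReal.ofReal_ne_top hR1, hR2⟩
  have hBr : B.toReal = CF * (normQ Ω T (R1 σ η τ fun z => -lam⁻¹ * ζ.toFun z)).toReal
      + (normQ Ω T (R2 ν η τ)).toReal := by
    rw [hB, ENNReal.toReal_add (ENNReal.mul_ne_top ENNReal.ofReal_ne_top hR1) hR2,
      ENNReal.toReal_mul, ENNReal.toReal_ofReal hC.le]
  rw [← hBr] at hfin
  have t1 : ENNReal.ofReal (CF ^ 2 / (mu1 νlow σlow ^ 2 * lam)) * A ^ 2 ≠ ⊤ :=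
    ENNReal.mul_ne_top ENNReal.ofReal_ne_top (ENNReal.pow_ne_top hAtop)
  have t2 : ENNReal.ofReal (1 / mu1 νlow σlow) * B * A ≠ ⊤ :=
    ENNReal.mul_ne_top (ENNReal.mul_ne_top ENNReal.ofReal_ne_top hBtop) hAtop
  rw [← EReal.coe_ennreal_toReal t1, ← EReal.coe_ennreal_toReal t2, ← EReal.coe_sub,
    ← EReal.coe_sub, EReal.coe_le_coe_iff]
  simp only [ENNReal.toReal_mul, ENNReal.toReal_pow]
  rwa [ENNReal.toReal_ofReal (by positivity), ENNReal.toReal_ofReal (by positivity)]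

end

end TimePeriodicControl

end

theorem mainTheorem1 {d : ℕ} (Ω : Set (Sp d)) (hΩ_open : IsOpen Ω)
    (hΩ_bdd : Bornology.IsBounded Ω) (T : ℝ) (hT : 0 < T)
    (σ ν : Sp d → ℝ)
    (hσ_meas : AEStronglyMeasurable σ (muOmega Ω)) (hν_meas : AEStronglyMeasurable ν (muOmega Ω))
    (σlow σup νlow νup : ℝ) (hσlow : 0 < σlow) (hνlow : 0 < νlow)
    (hσ : ∀ x ∈ Ω, σlow ≤ σ x ∧ σ x ≤ σup) (hν : ∀ x ∈ Ω, νlow ≤ ν x ∧ ν x ≤ νup)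
    (lam : ℝ) (hlam : 0 < lam)
    (yd : Sp d × ℝ → ℝ) (hyd : MemLp yd 2 (muQ Ω T))
    (CF : ℝ) (hCF : IsFriedrichsConstant Ω CF)
    (η ζ : H11ZeroPer Ω T) (τ ρ : HDiv Ω T) :
    minorant σ ν σlow νlow lam CF yd η ζ τ ρ ≤ optimalValue Ω T σ ν lam yd ∧
    ∀ (y : HHalfZeroPer Ω T) (u : Sp d × ℝ → ℝ), IsOptimal Ω T σ ν lam yd y u →
      minorant σ ν σlow νlow lam CF yd η ζ τ ρ ≤ (cost Ω T lam yd y.toFun u : EReal) := by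
  refine ⟨?_, fun y u h => ?_⟩
  · exact le_iInf fun y => le_iInf fun u => le_iInf fun h =>
      minorant_le_cost hΩ_open hΩ_bdd hT hσ_meas hν_meas hσlow hνlow hσ hν hlam hyd hCF η ζ τ ρ y h
  · exact minorant_le_cost hΩ_open hΩ_bdd hT hσ_meas hν_meas hσlow hνlow hσ hν hlam hyd hCF
      η ζ τ ρ y h.1
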